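/- Let $f_1,\dots,f_n$ and $g_1,\dots,g_m$ be real functions on $\mathbb{R}^d$, put $f=\frac1n\sum_i f_i$, $g=(g_1,\dots,g_m)$ and $\mathcal X=\{x: g_k(x)\le 0,\ k=1,\dots,m\}$, and assume: $\mathcal X$ is non-empty, convex, compact and contained in the ball $B=\{\|x\|\le R\}$; there is $x\in\operatorname{relint}\mathcal X$ with $g_k(x)<0$ for all $k$; all $f_i,g_k$ are convex on $B$; and sub-gradients $\nabla f_i(x)\in\partial f_i(x)$, $\nabla g_k(x)\in\partial g_k(x)$ (relative to $B$) are given for $x\in B$ with norms at most a constant $L$. Let $W$ be a doubly stochastic $n\times n$ matrix and $G$ a connected graph on $\{1,\dots,n\}$ such that, for $i\ne j$, $W_{ij}>0$ if $ij$ is an edge and $W_{ij}=0$ otherwise. For $\eta>0$ and $\alpha(t)=R/\sqrt{t+1}$ consider the distributed stochastic primal-dual method: $x_i(0)=0$, $\lambda_i(0)=0$; at step $t=0,1,2,\dots$ each agent $i$ draws $K_i(t)\in\{1,\dots,m\}$ such that, conditionally on the labels $K_j(s)$, $s<t$, $1\le j\le n$, one has $K_i(t)=k$ with probability $\lambda_{i,k}(t)/\|\lambda_i(t)\|_1$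 (with probability $1/m$ if $\lambda_i(t)=0$), and $$y_i(t)=x_i(t)-\alpha(t)\big(\nabla f_i(x_i(t))+\|\lambda_i(t)\|_1\nabla g_{K_i(t)}(x_i(t))\big),\qquad \gamma_i(t)=\lambda_i(t)+\alpha(t)\big(g(x_i(t))-\eta\lambda_i(t)\big),$$ $$x_i(t+1)=\Pi_B\Big(\sum_j W_{ij}y_j(t)\Big),\qquad \lambda_i(t+1)=\Big[\sum_j W_{ij}\gamma_j(t)\Big]_+ .$$ Let $\widehat x_i(T)=\sum_{t=0}^{T-1}\alpha(t)x_i(t)\big/\sum_{t=0}^{T-1}\alpha(t)$ and $V(T)=\big\|\big[\frac1n\sum_{i=1}^n g(\widehat x_i(T))\big]_+\big\|_2^2$. Then: (i) There is a constant $C$, independent of $\eta$ and $T$, such that for every $\eta>0$ with $\eta\alpha(t)\le\frac12$ for all $t$, and for all sufficiently large $T$ (depending on $\eta$), with probability at least $1-\frac1T$, $V(T)\le C\,\eta$. (ii) If moreover some minimizer $x_*$ of $f$ over $\mathcal X$ satisfies $g_k(x_*)<0$ for all $k$, then there is a constant $C$, independent of $\eta$ and $T$, such that for every $\eta>0$ with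 $\eta\alpha(t)\le\frac12$ for all $t$, and for all sufficiently large $T$ (depending on $\eta$), with probability at least $1-\frac1T$, $V(T)\le C\,\dfrac{\eta\log T}{\sqrt T}$. -/

import Mathlib

open MeasureTheory ProbabilityTheory Filter Finset
open scoped RealInnerProductSpace

noncomputable section

/-- The data of the distributed problem `min (1/n) ∑ i, f i x` subject to `g k x ≤ 0`, with `n` agents
and `m` constraints in `ℝ^d`: the objective functions, the constraint functions, the sub-gradients
`df`, `dg` that the agents use, the communication graph, the weight matrix, the radius `R` of the ball
onto which primal variables are projected, and the bound `L` on the sub-gradients. -/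
structure DistProblem (d n m : ℕ) where
  f : Fin n → EuclideanSpace ℝ (Fin d) → ℝ
  g : Fin m → EuclideanSpace ℝ (Fin d) → ℝ
  df : Fin n → EuclideanSpace ℝ (Fin d) → EuclideanSpace ℝ (Fin d)
  dg : Fin m → EuclideanSpace ℝ (Fin d) → EuclideanSpace ℝ (Fin d)
  G : SimpleGraph (Fin n)
  W : Matrix (Fin n) (Fin n) ℝ
  R : ℝ
  L : ℝ

/-- `v` is a sub-gradient at `x` of the function `φ` regarded as a function on `s`. -/
def IsSubgradientOn {d : ℕ} (s : Set (EuclideanSpace ℝ (Fin d)))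
    (φ : EuclideanSpace ℝ (Fin d) → ℝ) (x v : EuclideanSpace ℝ (Fin d)) : Prop :=
  ∀ y ∈ s, φ x + ⟪v, y - x⟫ ≤ φ y

/-- Projection onto the Euclidean ball of radius `R` around the origin, in closed form. -/
def projBall {d : ℕ} (R : ℝ) (z : EuclideanSpace ℝ (Fin d)) : EuclideanSpace ℝ (Fin d) :=
  (R / max R ‖z‖) • z

/-- The vector `[v]₊` of positive parts; this is the projection onto the non-negative orthant. -/
def posPartVec {m : ℕ} (v : EuclideanSpace ℝ (Fin m)) : EuclideanSpace ℝ (Fin m) :=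
  WithLp.toLp 2 fun k => max 0 (v k)

/-- The `ℓ₁` norm of a vector of Lagrangian multipliers. -/
def l1Norm {m : ℕ} (v : EuclideanSpace ℝ (Fin m)) : ℝ := ∑ k, |v k|

/-- The sampling distribution attached to a multiplier vector `v`: proportional to `v`, and uniform
on the constraint labels if `v = 0`. -/
def sampleProb {m : ℕ} (v : EuclideanSpace ℝ (Fin m)) (k : Fin m) : ℝ :=
  open Classical in if v = 0 then 1 / (m : ℝ) else v k / l1Norm v

namespace DistProblem

variable {d n m : ℕ} (P : DistProblem d n m)

/-- The ball of radius `R` around the origin. -/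
def ball : Set (EuclideanSpace ℝ (Fin d)) := Metric.closedBall 0 P.R

/-- The feasible set `{x : g k x ≤ 0 for all k}`. -/
def feasible : Set (EuclideanSpace ℝ (Fin d)) := {x | ∀ k, P.g k x ≤ 0}

/-- The global objective `(1/n) ∑ i, f i x`. -/
def objective (x : EuclideanSpace ℝ (Fin d)) : ℝ := (1 / (n : ℝ)) * ∑ i, P.f i x

/-- The constraint map `x ↦ (g 1 x, …, g m x)`. -/
def gVec (x : EuclideanSpace ℝ (Fin d)) : EuclideanSpace ℝ (Fin m) :=
  WithLp.toLp 2 fun k => P.g k x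

/-- The optimal solutions of the constrained problem. -/
def IsOptimal (x : EuclideanSpace ℝ (Fin d)) : Prop :=
  x ∈ P.feasible ∧ ∀ y ∈ P.feasible, P.objective x ≤ P.objective y

/-- The standing assumptions: compact feasible set inside the ball, Slater condition, convexity and
bounded sub-gradients on the ball, connected graph with a compatible doubly stochastic matrix
(the diagonal of `W` may or may not be positive). -/
structure Standing : Prop where
  feasible_nonempty : P.feasible.Nonempty
  feasible_convex : Convex ℝ P.feasible
  feasible_compact : IsCompact P.feasible
  feasible_subset : P.feasible ⊆ P.ball
  slater : ∃ x ∈ intrinsicInterior ℝ P.feasible, ∀ k, P.g k x < 0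
  f_convex : ∀ i, ConvexOn ℝ P.ball (P.f i)
  g_convex : ∀ k, ConvexOn ℝ P.ball (P.g k)
  df_mem : ∀ i, ∀ x ∈ P.ball, IsSubgradientOn P.ball (P.f i) x (P.df i x)
  dg_mem : ∀ k, ∀ x ∈ P.ball, IsSubgradientOn P.ball (P.g k) x (P.dg k x)
  df_bound : ∀ i, ∀ x ∈ P.ball, ‖P.df i x‖ ≤ P.L
  dg_bound : ∀ k, ∀ x ∈ P.ball, ‖P.dg k x‖ ≤ P.L
  connected : P.G.Connected
  doublyStoch : P.W ∈ doublyStochastic ℝ (Fin n)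
  weight_pos : ∀ i j, P.G.Adj i j → 0 < P.W i j
  weight_zero : ∀ i j, i ≠ j → ¬ P.G.Adj i j → P.W i j = 0

/-- The stepsize `α(t) = R / √(t+1)`. -/
def stepSize (t : ℕ) : ℝ := P.R / √((t : ℝ) + 1)

/-- Stochastic sub-gradient in the primal variable of agent `i`, for the sampled label `k`. -/
def gradX (i : Fin n) (x : EuclideanSpace ℝ (Fin d)) (v : EuclideanSpace ℝ (Fin m)) (k : Fin m) :
    EuclideanSpace ℝ (Fin d) :=
  P.df i x + l1Norm v • P.dg k x

/-- Gradient in the dual variable of the regularized Lagrangian. -/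
def gradDual (η : ℝ) (x : EuclideanSpace ℝ (Fin d)) (v : EuclideanSpace ℝ (Fin m)) :
    EuclideanSpace ℝ (Fin m) :=
  P.gVec x - η • v

/-- The primal and dual variables `(x i, λ i)` of all agents after `t` steps of the stochastic
primal-dual method with regularization parameter `η`, when agent `i` draws the label `κ s i` at
step `s`. -/
def iterates (η : ℝ) (κ : ℕ → Fin n → Fin m) :
    ℕ → (Fin n → EuclideanSpace ℝ (Fin d)) × (Fin n → EuclideanSpace ℝ (Fin m))
  | 0 => (fun _ => 0, fun _ => 0)
  | t + 1 =>
    let x := (iterates η κ t).1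
    let v := (iterates η κ t).2
    let y := fun j => x j - P.stepSize t • P.gradX j (x j) (v j) (κ t j)
    let γ := fun j => v j + P.stepSize t • P.gradDual η (x j) (v j)
    (fun i => projBall P.R (∑ j, P.W i j • y j), fun i => posPartVec (∑ j, P.W i j • γ j))

/-- The weighted average of agent `i` over the iterates `0, …, T-1`. -/
def average (η : ℝ) (κ : ℕ → Fin n → Fin m) (T : ℕ) (i : Fin n) : EuclideanSpace ℝ (Fin d) :=
  (∑ t ∈ range T, P.stepSize t)⁻¹ • ∑ t ∈ range T, P.stepSize t • (P.iterates η κ t).1 i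

/-- The constraint violation `‖[(1/n) ∑ i, g (average i)]₊‖²`. -/
def violation (η : ℝ) (κ : ℕ → Fin n → Fin m) (T : ℕ) : ℝ :=
  ‖posPartVec ((1 / (n : ℝ)) • ∑ i, P.gVec (P.average η κ T i))‖ ^ 2

/-- `K t ω i` is the random label drawn by agent `i` at step `t`: conditionally on the past `𝔉ₜ`, its
law is the sampling distribution attached to the current multiplier of agent `i`. The earlier
iterates and the iterate at step `t` are functions of the labels drawn before step `t`, so `𝔉ₜ` is
generated by these labels. The joint conditional law across agents is arbitrary. -/
structure IsSampling (η : ℝ) {Ω : Type*} [MeasurableSpace Ω] (μ : Measure Ω)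
    (K : ℕ → Ω → Fin n → Fin m) : Prop where
  measurable : ∀ t, Measurable (K t)
  cond_law : ∀ t i k,
    μ[Set.indicator {ω | K t ω i = k} (fun _ => (1 : ℝ)) |
        MeasurableSpace.comap (fun ω (s : Fin t) => K s ω) inferInstance]
      =ᵐ[μ] fun ω => sampleProb ((P.iterates η (fun s => K s ω) t).2 i) k

end DistProblem

end

/-! ### Projections and averaging -/

/-! For fixed feasible `z` and any `v ≥ 0`, follow the summed squared distance of the agents from
`(z, v)`. Mixing by `W` does not increase it (Jensen, column sums one) and neither do the
projections, so a step changes it by at most the linearized Lagrangian gap, the sampling error and a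
term `α² A (1 + ‖λ‖²)`. The inequality is pathwise and the error does not involve `v`. Hence `v` may
depend on the whole trajectory, and `v = [ḡ]₊ / η`, with `ḡ` the agents' mean of `g` at their
averages, turns the gap into a multiple of `S V / η`, where `S = ∑ α`.

The regularization supplies `-α η ‖λ‖²`. It absorbs all terms `α² ‖λ‖²` once `α` is small compared
with `η`; the finitely many earlier steps contribute a constant depending on `η`, since `‖λ‖ ≤ Γ /
η`. The sampling error is a martingale whose increments have a predictable bound, so an exponential
supermartingale and Markov's inequality control it by `log T` plus half the sum of the squared
bounds, again of the form `α² ‖λ‖²`. This gives `S V / η ≲ log T + C'(η) - 2 ∑ α (f(x) - f(z))`,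
with `S ≥ R √T`.

For (i), the objective term is bounded crudely by a multiple of `S`. For (ii), it must be `O(log
T)`. A strictly feasible minimizer minimizes `f` over the whole ball, but `f_j` is evaluated at
`x_j`, and the agents need not reach consensus, because `W` may be periodic. Instead the gap is
bounded below by linear functionals of the disagreement (Hahn–Banach). Solving `l - l̄ = h - Wᵀ h`,
which needs only connectedness, rewrites these as `h(x - W x)`. As `x(t+1) = W x(t)` up to order
`α`, the sum telescopes. The carrying lemmas are `violation_le`, `integral_exp_noise_le`,
`exists_functionals` and `exists_poisson_solution`. -/

theorem norm_projBall_le {d : ℕ} {R : ℝ} (hR : 0 < R) (z : EuclideanSpace ℝ (Fin d)) :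
    ‖projBall R z‖ ≤ R := by
  have h : 0 < max R ‖z‖ := lt_max_of_lt_left hR
  rw [projBall, norm_smul, Real.norm_eq_abs, abs_of_nonneg (by positivity), div_mul_eq_mul_div,
    div_le_iff₀ h]
  exact mul_le_mul_of_nonneg_left (le_max_right _ _) hR.le

theorem norm_projBall_sub_le {d : ℕ} {R : ℝ} (hR : 0 < R) (z : EuclideanSpace ℝ (Fin d))
    {p : EuclideanSpace ℝ (Fin d)} (hp : ‖p‖ ≤ R) : ‖projBall R z - p‖ ≤ ‖z - p‖ := by
  rcases le_total ‖z‖ R with h | h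
  · rw [projBall, max_eq_left h, div_self hR.ne', one_smul]
  · have hz : 0 < ‖z‖ := hR.trans_le h
    rw [projBall, max_eq_right h]
    set c := R / ‖z‖ with hc
    have hc0 : 0 ≤ c := by positivity
    have hc1 : c ≤ 1 := (div_le_one hz).2 h
    have hcz : c * ‖z‖ = R := div_mul_cancel₀ _ hz.ne'
    have hin : ⟪z, p⟫ ≤ ‖z‖ * R :=
      (real_inner_le_norm z p).trans (mul_le_mul_of_nonneg_left hp hz.le)
    refine le_of_sq_le_sq ?_ (norm_nonneg _)
    rw [norm_sub_sq_real, norm_sub_sq_real, norm_smul, real_inner_smul_left, Real.norm_eq_abs,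
      abs_of_nonneg hc0, hcz]
    have h1 : (1 - c) * ⟪z, p⟫ ≤ (1 - c) * (‖z‖ * R) :=
      mul_le_mul_of_nonneg_left hin (by linarith)
    have h2 : (1 - c) * (‖z‖ * R) = (‖z‖ - R) * R := by rw [← hcz]; ring
    nlinarith [sq_nonneg (‖z‖ - R)]

theorem norm_posPartVec_sub_le {m : ℕ} (v : EuclideanSpace ℝ (Fin m))
    {w : EuclideanSpace ℝ (Fin m)} (hw : ∀ k, 0 ≤ w k) : ‖posPartVec v - w‖ ≤ ‖v - w‖ := by
  refine le_of_sq_le_sq ?_ (norm_nonneg _)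
  rw [EuclideanSpace.real_norm_sq_eq, EuclideanSpace.real_norm_sq_eq]
  refine sum_le_sum fun k _ => ?_
  simp only [posPartVec, PiLp.sub_apply]
  rcases le_total 0 (v k) with h | h
  · rw [max_eq_right h]
  · rw [max_eq_left h]
    nlinarith [hw k]

theorem norm_posPartVec_le {m : ℕ} (v : EuclideanSpace ℝ (Fin m)) : ‖posPartVec v‖ ≤ ‖v‖ := by
  simpa using norm_posPartVec_sub_le v (w := 0) (by simp)

theorem inner_posPartVec_self {m : ℕ} (v : EuclideanSpace ℝ (Fin m)) :
    ⟪posPartVec v, v⟫ = ‖posPartVec v‖ ^ 2 := by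
  rw [EuclideanSpace.real_norm_sq_eq, PiLp.inner_apply]
  refine sum_congr rfl fun k _ => ?_
  simp only [posPartVec, RCLike.inner_apply, conj_trivial]
  rcases le_total 0 (v k) with h | h
  · rw [max_eq_right h]; ring
  · rw [max_eq_left h]; ring

theorem l1Norm_nonneg {m : ℕ} (v : EuclideanSpace ℝ (Fin m)) : 0 ≤ l1Norm v :=
  sum_nonneg fun _ _ => abs_nonneg _

theorem l1Norm_eq_sum {m : ℕ} {v : EuclideanSpace ℝ (Fin m)} (hv : ∀ k, 0 ≤ v k) :
    l1Norm v = ∑ k, v k := sum_congr rfl fun k _ => abs_of_nonneg (hv k)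

theorem sq_l1Norm_le {m : ℕ} (v : EuclideanSpace ℝ (Fin m)) : l1Norm v ^ 2 ≤ m * ‖v‖ ^ 2 := by
  have := sq_sum_le_card_mul_sum_sq (s := univ) (f := fun k => |v k|)
  simpa [l1Norm, EuclideanSpace.real_norm_sq_eq] using this

theorem sum_smul_sub_of_sum_eq_one {ι E : Type*} [AddCommGroup E] [Module ℝ E] {s : Finset ι}
    {w : ι → ℝ} (h1 : ∑ j ∈ s, w j = 1) (y : ι → E) (z : E) :
    ∑ j ∈ s, w j • y j - z = ∑ j ∈ s, w j • (y j - z) := by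
  simp_rw [smul_sub, sum_sub_distrib, ← sum_smul, h1, one_smul]

theorem norm_sum_smul_le {ι E : Type*} [NormedAddCommGroup E] [NormedSpace ℝ E] (s : Finset ι)
    {w : ι → ℝ} (h0 : ∀ j, 0 ≤ w j) (y : ι → E) :
    ‖∑ j ∈ s, w j • y j‖ ≤ ∑ j ∈ s, w j * ‖y j‖ :=
  (norm_sum_le _ _).trans_eq <| sum_congr rfl fun j _ => by
    rw [norm_smul, Real.norm_eq_abs, abs_of_nonneg (h0 j)]

theorem sum_sq_norm_doublyStochastic_le {n : ℕ} {E : Type*} [NormedAddCommGroup E]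
    [NormedSpace ℝ E] {W : Matrix (Fin n) (Fin n) ℝ} (hW : W ∈ doublyStochastic ℝ (Fin n))
    (y : Fin n → E) (z : E) :
    ∑ i, ‖∑ j, W i j • y j - z‖ ^ 2 ≤ ∑ j, ‖y j - z‖ ^ 2 := by
  obtain ⟨h0, h1, h2⟩ := mem_doublyStochastic_iff_sum.1 hW
  calc ∑ i, ‖∑ j, W i j • y j - z‖ ^ 2 ≤ ∑ i, ∑ j, W i j * ‖y j - z‖ ^ 2 := by
        refine sum_le_sum fun i _ => ?_
        rw [sum_smul_sub_of_sum_eq_one (h1 i)]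
        exact (pow_le_pow_left₀ (norm_nonneg _) (norm_sum_smul_le _ (h0 i) _) 2).trans
          (Real.pow_arith_mean_le_arith_mean_pow _ _ _ (fun j _ => h0 i j) (h1 i)
            (fun j _ => norm_nonneg _) 2)
    _ = ∑ j, ‖y j - z‖ ^ 2 := by
        rw [sum_comm]
        exact sum_congr rfl fun j _ => by rw [← sum_mul, h2, one_mul]

namespace DistProblem

variable {d n m : ℕ} {P : DistProblem d n m}

/-! ### Elementary properties of the iterates -/

theorem mem_ball_iff {x : EuclideanSpace ℝ (Fin d)} : x ∈ P.ball ↔ ‖x‖ ≤ P.R := by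
  simp [ball]

theorem Standing.card_pos (hP : P.Standing) : 0 < n := by
  obtain ⟨i⟩ := hP.connected.nonempty
  exact i.pos

theorem Standing.zero_le_radius (hP : P.Standing) : 0 ≤ P.R := by
  obtain ⟨x, hx⟩ := hP.feasible_nonempty
  exact (norm_nonneg x).trans (mem_ball_iff.1 (hP.feasible_subset hx))

theorem Standing.zero_mem_ball (hP : P.Standing) : (0 : EuclideanSpace ℝ (Fin d)) ∈ P.ball :=
  mem_ball_iff.2 (by simpa using hP.zero_le_radius)

theorem Standing.zero_le_lipschitz (hP : P.Standing) : 0 ≤ P.L :=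
  (norm_nonneg _).trans (hP.df_bound ⟨0, hP.card_pos⟩ 0 hP.zero_mem_ball)

theorem convex_ball : Convex ℝ P.ball := convex_closedBall _ _

theorem iterates_fst_succ (η : ℝ) (κ : ℕ → Fin n → Fin m) (t : ℕ) (i : Fin n) :
    (P.iterates η κ (t + 1)).1 i = projBall P.R (∑ j, P.W i j • ((P.iterates η κ t).1 j -
      P.stepSize t • P.gradX j ((P.iterates η κ t).1 j) ((P.iterates η κ t).2 j) (κ t j))) := rfl

theorem iterates_snd_succ (η : ℝ) (κ : ℕ → Fin n → Fin m) (t : ℕ) (i : Fin n) :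
    (P.iterates η κ (t + 1)).2 i = posPartVec (∑ j, P.W i j • ((P.iterates η κ t).2 j +
      P.stepSize t • P.gradDual η ((P.iterates η κ t).1 j) ((P.iterates η κ t).2 j))) := rfl

theorem iterates_congr (η : ℝ) {κ κ' : ℕ → Fin n → Fin m} {t : ℕ} (h : ∀ s < t, κ s = κ' s) :
    P.iterates η κ t = P.iterates η κ' t := by
  induction t with
  | zero => rfl
  | succ t ih => simp only [iterates, ih fun s hs => h s (by omega), h t (by omega)]

theorem iterates_fst_mem_ball (hR : 0 < P.R) (η : ℝ) (κ : ℕ → Fin n → Fin m) (t : ℕ) (i : Fin n) :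
    (P.iterates η κ t).1 i ∈ P.ball := by
  rw [mem_ball_iff]
  cases t with
  | zero => simpa [iterates] using hR.le
  | succ t => exact norm_projBall_le hR _

theorem iterates_snd_nonneg (η : ℝ) (κ : ℕ → Fin n → Fin m) (t : ℕ) (i : Fin n) (k : Fin m) :
    0 ≤ (P.iterates η κ t).2 i k := by
  cases t with
  | zero => simp [iterates]
  | succ t => exact le_max_left _ _

theorem stepSize_pos (hR : 0 < P.R) (t : ℕ) : 0 < P.stepSize t := by
  unfold stepSize; positivity

theorem sq_stepSize (t : ℕ) : P.stepSize t ^ 2 = P.R ^ 2 / ((t : ℝ) + 1) := by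
  rw [stepSize, div_pow, Real.sq_sqrt (by positivity)]

theorem stepSize_antitone (hR : 0 < P.R) : Antitone P.stepSize := fun s t h => by
  unfold stepSize
  gcongr

theorem Standing.f_sub_le (hP : P.Standing) (i : Fin n) {x y : EuclideanSpace ℝ (Fin d)}
    (hx : x ∈ P.ball) (hy : y ∈ P.ball) : P.f i x - P.f i y ≤ P.L * ‖x - y‖ := by
  have h1 := hP.df_mem i x hx y hy
  have h2 : ⟪P.df i x, x - y⟫ ≤ P.L * ‖x - y‖ := (real_inner_le_norm _ _).trans
    (mul_le_mul_of_nonneg_right (hP.df_bound i x hx) (norm_nonneg _))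
  rw [← neg_sub x y, inner_neg_right] at h1
  linarith

theorem Standing.exists_norm_gVec_le (hP : P.Standing) :
    ∃ Γ : ℝ, 0 ≤ Γ ∧ ∀ x ∈ P.ball, ‖P.gVec x‖ ≤ Γ := by
  refine ⟨√(∑ k, (|P.g k 0| + P.L * P.R) ^ 2), Real.sqrt_nonneg _, fun x hx => ?_⟩
  rw [EuclideanSpace.norm_eq]
  refine Real.sqrt_le_sqrt (sum_le_sum fun k _ => pow_le_pow_left₀ (norm_nonneg _) ?_ 2)
  have hxR := mem_ball_iff.1 hx
  have hL := hP.zero_le_lipschitz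
  have key : ∀ y ∈ P.ball, |⟪P.dg k y, x⟫| ≤ P.L * P.R := fun y hy =>
    (abs_real_inner_le_norm _ _).trans
      (mul_le_mul (hP.dg_bound k y hy) hxR (norm_nonneg _) hL)
  have h1 := hP.dg_mem k 0 hP.zero_mem_ball x hx
  have h2 := hP.dg_mem k x hx 0 hP.zero_mem_ball
  rw [sub_zero] at h1
  rw [zero_sub, inner_neg_right] at h2
  have h3 := abs_le.1 (key 0 hP.zero_mem_ball)
  have h4 := abs_le.1 (key x hx)
  rw [Real.norm_eq_abs, abs_le]
  change -(|P.g k 0| + P.L * P.R) ≤ P.g k x ∧ P.g k x ≤ _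
  constructor <;> linarith [h3.1, h4.2, neg_abs_le (P.g k 0), le_abs_self (P.g k 0)]

/-- Before mixing, the new multiplier is the convex combination of `λ` and `g / η` with weights `1 -
η α` and `η α`, so the ball of radius `Γ / η` is preserved. -/
theorem Standing.norm_iterates_snd_le (hP : P.Standing) (hR : 0 < P.R) {Γ η : ℝ} (hΓ0 : 0 ≤ Γ)
    (hΓ : ∀ x ∈ P.ball, ‖P.gVec x‖ ≤ Γ) (hη : 0 < η) (hα : ∀ t, η * P.stepSize t ≤ 1 / 2)
    (κ : ℕ → Fin n → Fin m) (t : ℕ) (i : Fin n) : ‖(P.iterates η κ t).2 i‖ ≤ Γ / η := by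
  induction t generalizing i with
  | zero => simpa [iterates] using div_nonneg hΓ0 hη.le
  | succ t ih =>
    obtain ⟨h0, h1, -⟩ := mem_doublyStochastic_iff_sum.1 hP.doublyStoch
    rw [iterates_snd_succ]
    refine (norm_posPartVec_le _).trans ((norm_sum_smul_le _ (h0 i) _).trans ?_)
    calc _ ≤ ∑ j, P.W i j * (Γ / η) := by
          refine sum_le_sum fun j _ => mul_le_mul_of_nonneg_left ?_ (h0 i j)
          have ha := stepSize_pos hR t
          have hx := hΓ _ (iterates_fst_mem_ball hR η κ t j)
          have hr : (P.iterates η κ t).2 j + P.stepSize t • P.gradDual η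
              ((P.iterates η κ t).1 j) ((P.iterates η κ t).2 j) =
              (1 - η * P.stepSize t) • (P.iterates η κ t).2 j +
                P.stepSize t • P.gVec ((P.iterates η κ t).1 j) := by
            rw [gradDual]; module
          rw [hr]
          have hc : 0 ≤ 1 - η * P.stepSize t := by linarith [hα t]
          refine (norm_add_le _ _).trans ?_
          rw [norm_smul, norm_smul, Real.norm_of_nonneg hc, Real.norm_of_nonneg ha.le]
          calc _ ≤ (1 - η * P.stepSize t) * (Γ / η) + P.stepSize t * Γ := by
                gcongr; exact ih j
            _ = Γ / η := by field_simp; ring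
      _ = Γ / η := by rw [← sum_mul, h1, one_mul]

/-! ### The primal-dual inequality -/

/-- The sampling error at step `t`, tested against `x j - z` and summed over the agents. -/
noncomputable def noise (P : DistProblem d n m) (η : ℝ) (κ : ℕ → Fin n → Fin m)
    (z : EuclideanSpace ℝ (Fin d)) (t : ℕ) : ℝ :=
  ∑ j, (∑ k, (P.iterates η κ t).2 j k *
      ⟪P.dg k ((P.iterates η κ t).1 j), (P.iterates η κ t).1 j - z⟫ -
    l1Norm ((P.iterates η κ t).2 j) *
      ⟪P.dg (κ t j) ((P.iterates η κ t).1 j), (P.iterates η κ t).1 j - z⟫)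

theorem Standing.norm_gradX_le (hP : P.Standing) (i : Fin n) {x : EuclideanSpace ℝ (Fin d)}
    (hx : x ∈ P.ball) (v : EuclideanSpace ℝ (Fin m)) (k : Fin m) :
    ‖P.gradX i x v k‖ ≤ P.L * (1 + l1Norm v) := by
  refine (norm_add_le _ _).trans ?_
  rw [norm_smul, Real.norm_of_nonneg (l1Norm_nonneg v)]
  linarith [hP.df_bound i x hx, mul_le_mul_of_nonneg_left (hP.dg_bound k x hx) (l1Norm_nonneg v)]

/-- The point is that `A` does not depend on `η`: the step condition at `t = 0`, where `α = R`,
forces `η ≤ 1 / (2 R)`. -/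
theorem Standing.exists_sq_grad_le (hP : P.Standing) (hR : 0 < P.R) :
    ∃ A : ℝ, 0 ≤ A ∧ ∀ η : ℝ, 0 < η → (∀ t, η * P.stepSize t ≤ 1 / 2) →
      ∀ x ∈ P.ball, ∀ v : EuclideanSpace ℝ (Fin m),
        (P.L * (1 + l1Norm v)) ^ 2 + ‖P.gradDual η x v‖ ^ 2 ≤ A * (1 + ‖v‖ ^ 2) := by
  obtain ⟨Γ, hΓ0, hΓ⟩ := hP.exists_norm_gVec_le
  refine ⟨2 * P.L ^ 2 * (1 + m) + 2 * Γ ^ 2 + 2 * (1 / (2 * P.R)) ^ 2, by positivity,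
    fun η hη hα x hx v => ?_⟩
  have hη' : η ≤ 1 / (2 * P.R) := by
    have := hα 0
    rw [stepSize] at this
    rw [le_div_iff₀ (by positivity)]
    norm_num at this
    linarith
  have h1 : (P.L * (1 + l1Norm v)) ^ 2 ≤ 2 * P.L ^ 2 * (1 + m) * (1 + ‖v‖ ^ 2) := by
    have h2 : (1 + l1Norm v) ^ 2 ≤ 2 * ((1 + m) * (1 + ‖v‖ ^ 2)) := by
      nlinarith [sq_l1Norm_le v, sq_nonneg (1 - l1Norm v), sq_nonneg ‖v‖,
        (Nat.cast_nonneg m : (0 : ℝ) ≤ m)]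
    rw [mul_pow]
    nlinarith [mul_le_mul_of_nonneg_left h2 (sq_nonneg P.L)]
  have h3 : ‖P.gradDual η x v‖ ^ 2 ≤ (2 * Γ ^ 2 + 2 * (1 / (2 * P.R)) ^ 2) * (1 + ‖v‖ ^ 2) := by
    have h4 : ‖P.gradDual η x v‖ ≤ Γ + 1 / (2 * P.R) * ‖v‖ := by
      refine (norm_sub_le _ _).trans ?_
      rw [norm_smul, Real.norm_of_nonneg hη.le]
      exact add_le_add (hΓ x hx) (mul_le_mul_of_nonneg_right hη' (norm_nonneg _))
    refine (pow_le_pow_left₀ (norm_nonneg _) h4 2).trans ?_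
    set c := 1 / (2 * P.R)
    nlinarith [sq_nonneg (Γ - c * ‖v‖), sq_nonneg (Γ * ‖v‖), sq_nonneg c]
  linarith

/-- Convexity gives the bound for the full sub-gradient, with `g k z ≤ 0` discarded by feasibility;
the bracket is the price of sampling a single label. -/
theorem Standing.inner_gradX_ge (hP : P.Standing) (j : Fin n) {x z : EuclideanSpace ℝ (Fin d)}
    (hx : x ∈ P.ball) (hz : z ∈ P.feasible) {v : EuclideanSpace ℝ (Fin m)} (hv : ∀ k, 0 ≤ v k)
    (k₀ : Fin m) :
    P.f j x - P.f j z + ⟪v, P.gVec x⟫ -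
      (∑ k, v k * ⟪P.dg k x, x - z⟫ - l1Norm v * ⟪P.dg k₀ x, x - z⟫) ≤
        ⟪P.gradX j x v k₀, x - z⟫ := by
  have hzb := hP.feasible_subset hz
  have h1 := hP.df_mem j x hx z hzb
  rw [← neg_sub x z, inner_neg_right] at h1
  have h2 : ⟪v, P.gVec x⟫ ≤ ∑ k, v k * ⟪P.dg k x, x - z⟫ := by
    rw [PiLp.inner_apply]
    refine sum_le_sum fun k _ => ?_
    have h3 := hP.dg_mem k x hx z hzb
    rw [← neg_sub x z, inner_neg_right] at h3
    have h4 : P.g k x ≤ ⟪P.dg k x, x - z⟫ := by linarith [hz k]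
    calc _ = v k * P.g k x := by simp [gVec, mul_comm]
      _ ≤ _ := mul_le_mul_of_nonneg_left h4 (hv k)
  rw [gradX, inner_add_left, real_inner_smul_left]
  linarith

/-- Strong concavity in the dual variable leaves the term `-η / 2 * ‖u‖ ^ 2`, which later absorbs
the second-order errors. -/
theorem inner_gradDual_le {η : ℝ} (hη : 0 ≤ η) (x : EuclideanSpace ℝ (Fin d))
    (u v : EuclideanSpace ℝ (Fin m)) :
    ⟪P.gradDual η x u, u - v⟫ ≤
      ⟪u, P.gVec x⟫ - ⟪v, P.gVec x⟫ - η / 2 * ‖u‖ ^ 2 + η / 2 * ‖v‖ ^ 2 := by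
  have h := mul_nonneg hη (sq_nonneg ‖u - v‖)
  rw [norm_sub_sq_real] at h
  rw [gradDual, inner_sub_left, inner_sub_right, inner_sub_right, real_inner_smul_left,
    real_inner_smul_left, real_inner_self_eq_norm_sq, real_inner_comm u, real_inner_comm v]
  linarith

theorem Standing.sum_sq_dist_succ_le (hP : P.Standing) (hR : 0 < P.R) {A η : ℝ} (hη : 0 < η)
    (hA : ∀ x ∈ P.ball, ∀ v : EuclideanSpace ℝ (Fin m),
      (P.L * (1 + l1Norm v)) ^ 2 + ‖P.gradDual η x v‖ ^ 2 ≤ A * (1 + ‖v‖ ^ 2))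
    (κ : ℕ → Fin n → Fin m) {z : EuclideanSpace ℝ (Fin d)} (hz : z ∈ P.feasible)
    {v : EuclideanSpace ℝ (Fin m)} (hv : ∀ k, 0 ≤ v k) (t : ℕ) :
    ∑ j, (‖(P.iterates η κ (t + 1)).1 j - z‖ ^ 2 + ‖(P.iterates η κ (t + 1)).2 j - v‖ ^ 2) ≤
      ∑ j, (‖(P.iterates η κ t).1 j - z‖ ^ 2 + ‖(P.iterates η κ t).2 j - v‖ ^ 2) +
      (2 * (P.stepSize t * P.noise η κ z t) -
      ∑ j, (2 * P.stepSize t * (P.f j ((P.iterates η κ t).1 j) - P.f j z) +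
        2 * P.stepSize t * ⟪v, P.gVec ((P.iterates η κ t).1 j)⟫ +
        P.stepSize t * η * ‖(P.iterates η κ t).2 j‖ ^ 2 - P.stepSize t * η * ‖v‖ ^ 2 -
        P.stepSize t ^ 2 * (A * (1 + ‖(P.iterates η κ t).2 j‖ ^ 2)))) := by
  have hzR := mem_ball_iff.1 (hP.feasible_subset hz)
  have ha := stepSize_pos hR t
  set a := P.stepSize t with ha'
  have hp : ∑ j, ‖(P.iterates η κ (t + 1)).1 j - z‖ ^ 2 ≤ _ :=
    (sum_le_sum fun j _ => pow_le_pow_left₀ (norm_nonneg _)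
      ((iterates_fst_succ η κ t j).symm ▸ norm_projBall_sub_le hR _ hzR) 2).trans
      (sum_sq_norm_doublyStochastic_le hP.doublyStoch _ z)
  have hd : ∑ j, ‖(P.iterates η κ (t + 1)).2 j - v‖ ^ 2 ≤ _ :=
    (sum_le_sum fun j _ => pow_le_pow_left₀ (norm_nonneg _)
      ((iterates_snd_succ η κ t j).symm ▸ norm_posPartVec_sub_le _ hv) 2).trans
      (sum_sq_norm_doublyStochastic_le hP.doublyStoch _ v)
  rw [sum_add_distrib]
  refine (add_le_add hp hd).trans ?_
  rw [noise, mul_sum, mul_sum, ← sum_sub_distrib, ← sum_add_distrib, ← sum_add_distrib]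
  refine sum_le_sum fun j _ => ?_
  have hx := iterates_fst_mem_ball hR η κ t j
  have hl := iterates_snd_nonneg (P := P) η κ t j
  rw [← ha']
  generalize (P.iterates η κ t).1 j = x at *
  generalize (P.iterates η κ t).2 j = u at *
  have h1 := hP.inner_gradX_ge j hx hz hl (κ t j)
  have h2 := inner_gradDual_le (P := P) hη.le x u v
  have h3 := hA x hx u
  have h4 := pow_le_pow_left₀ (norm_nonneg _) (hP.norm_gradX_le j hx u (κ t j)) 2
  have e1 : x - a • P.gradX j x u (κ t j) - z = (x - z) - a • P.gradX j x u (κ t j) := by abel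
  have e2 : u + a • P.gradDual η x u - v = (u - v) + a • P.gradDual η x u := by abel
  rw [e1, e2, norm_sub_sq_real, norm_add_sq_real, norm_smul, norm_smul, real_inner_smul_right,
    real_inner_smul_right, real_inner_comm, real_inner_comm _ (u - v), Real.norm_of_nonneg ha.le]
  have h5 := mul_le_mul_of_nonneg_left h1 ha.le
  have h6 := mul_le_mul_of_nonneg_left h2 ha.le
  have h7 := mul_le_mul_of_nonneg_left ((add_le_add h4 le_rfl).trans h3) (sq_nonneg a)
  linarith

theorem Standing.sum_gap_le (hP : P.Standing) (hR : 0 < P.R) {A η : ℝ} (hη : 0 < η)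
    (hA : ∀ x ∈ P.ball, ∀ v : EuclideanSpace ℝ (Fin m),
      (P.L * (1 + l1Norm v)) ^ 2 + ‖P.gradDual η x v‖ ^ 2 ≤ A * (1 + ‖v‖ ^ 2))
    (κ : ℕ → Fin n → Fin m) {z : EuclideanSpace ℝ (Fin d)} (hz : z ∈ P.feasible)
    {v : EuclideanSpace ℝ (Fin m)} (hv : ∀ k, 0 ≤ v k) (T : ℕ) :
    ∑ t ∈ range T, ∑ j, (2 * P.stepSize t * (P.f j ((P.iterates η κ t).1 j) - P.f j z) +
        2 * P.stepSize t * ⟪v, P.gVec ((P.iterates η κ t).1 j)⟫ +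
        P.stepSize t * η * ‖(P.iterates η κ t).2 j‖ ^ 2 - P.stepSize t * η * ‖v‖ ^ 2 -
        P.stepSize t ^ 2 * (A * (1 + ‖(P.iterates η κ t).2 j‖ ^ 2))) ≤
      n * (P.R ^ 2 + ‖v‖ ^ 2) + 2 * ∑ t ∈ range T, P.stepSize t * P.noise η κ z t := by
  have key : ∑ j, (‖(P.iterates η κ T).1 j - z‖ ^ 2 + ‖(P.iterates η κ T).2 j - v‖ ^ 2) ≤
      ∑ j, (‖(P.iterates η κ 0).1 j - z‖ ^ 2 + ‖(P.iterates η κ 0).2 j - v‖ ^ 2) +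
      ∑ t ∈ range T, (2 * (P.stepSize t * P.noise η κ z t) -
      ∑ j, (2 * P.stepSize t * (P.f j ((P.iterates η κ t).1 j) - P.f j z) +
        2 * P.stepSize t * ⟪v, P.gVec ((P.iterates η κ t).1 j)⟫ +
        P.stepSize t * η * ‖(P.iterates η κ t).2 j‖ ^ 2 - P.stepSize t * η * ‖v‖ ^ 2 -
        P.stepSize t ^ 2 * (A * (1 + ‖(P.iterates η κ t).2 j‖ ^ 2)))) := by
    induction T with
    | zero => simp
    | succ T ih =>
      rw [sum_range_succ]
      linarith [hP.sum_sq_dist_succ_le hR hη hA κ hz hv T]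
  have h0 : 0 ≤ ∑ j, (‖(P.iterates η κ T).1 j - z‖ ^ 2 + ‖(P.iterates η κ T).2 j - v‖ ^ 2) :=
    sum_nonneg fun _ _ => by positivity
  have h1 : ∑ j, (‖(P.iterates η κ 0).1 j - z‖ ^ 2 + ‖(P.iterates η κ 0).2 j - v‖ ^ 2) ≤
      n * (P.R ^ 2 + ‖v‖ ^ 2) := by
    have := pow_le_pow_left₀ (norm_nonneg _) (mem_ball_iff.1 (hP.feasible_subset hz)) 2
    simp only [iterates, zero_sub, norm_neg, sum_const, card_univ, Fintype.card_fin, nsmul_eq_mul]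
    gcongr
  rw [sum_sub_distrib, ← mul_sum] at key
  linarith

theorem Standing.gVec_average_le (hP : P.Standing) (hR : 0 < P.R) (η : ℝ)
    (κ : ℕ → Fin n → Fin m) {T : ℕ} (hT : 0 < T) (j : Fin n) (k : Fin m) :
    (∑ t ∈ range T, P.stepSize t) * P.g k (P.average η κ T j) ≤
      ∑ t ∈ range T, P.stepSize t * P.g k ((P.iterates η κ t).1 j) := by
  have hS : 0 < ∑ t ∈ range T, P.stepSize t :=
    sum_pos (fun t _ => stepSize_pos hR t) (nonempty_range_iff.2 hT.ne')
  have := (hP.g_convex k).map_sum_le (t := range T)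
    (w := fun t => (∑ t ∈ range T, P.stepSize t)⁻¹ * P.stepSize t)
    (p := fun t => (P.iterates η κ t).1 j)
    (fun t _ => mul_nonneg (inv_nonneg.2 hS.le) (stepSize_pos hR t).le)
    (by rw [← mul_sum, inv_mul_cancel₀ hS.ne'])
    (fun t _ => iterates_fst_mem_ball hR η κ t j)
  simp only [mul_smul, smul_eq_mul, ← smul_sum, mul_assoc, ← mul_sum] at this
  rwa [← div_eq_inv_mul, le_div_iff₀' hS] at this

/-- The comparison multiplier is chosen along the trajectory. This is legitimate because
`sum_gap_le` holds pathwise for every `v` and its noise term depends only on `z`. -/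
theorem Standing.violation_le (hP : P.Standing) (hR : 0 < P.R) {A η : ℝ} (hη : 0 < η)
    (hA : ∀ x ∈ P.ball, ∀ v : EuclideanSpace ℝ (Fin m),
      (P.L * (1 + l1Norm v)) ^ 2 + ‖P.gradDual η x v‖ ^ 2 ≤ A * (1 + ‖v‖ ^ 2))
    (κ : ℕ → Fin n → Fin m) {z : EuclideanSpace ℝ (Fin d)} (hz : z ∈ P.feasible) {T : ℕ}
    (hT : 2 / η ≤ ∑ t ∈ range T, P.stepSize t) :
    n * (∑ t ∈ range T, P.stepSize t) * P.violation η κ T / (2 * η) ≤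
      n * P.R ^ 2 + 2 * ∑ t ∈ range T, P.stepSize t * P.noise η κ z t +
      ∑ t ∈ range T, ∑ j, (P.stepSize t ^ 2 * (A * (1 + ‖(P.iterates η κ t).2 j‖ ^ 2)) -
        P.stepSize t * η * ‖(P.iterates η κ t).2 j‖ ^ 2 -
        2 * P.stepSize t * (P.f j ((P.iterates η κ t).1 j) - P.f j z)) := by
  have hn : (0 : ℝ) < n := Nat.cast_pos.2 hP.card_pos
  have hT0 : 0 < T := by
    rcases Nat.eq_zero_or_pos T with rfl | h
    · exact absurd hT (by simpa using hη)
    · exact h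
  set S := ∑ t ∈ range T, P.stepSize t with hS
  set gb := (1 / (n : ℝ)) • ∑ i, P.gVec (P.average η κ T i) with hgb
  set V := P.violation η κ T with hV
  have hV' : V = ‖posPartVec gb‖ ^ 2 := rfl
  have hV0 : 0 ≤ V := by rw [hV']; positivity
  -- This choice makes `2 * ⟪v, gb⟫ - η * ‖v‖ ^ 2` equal to `V / η`.
  set v := (1 / η) • posPartVec gb with hv
  have hv0 : ∀ k, 0 ≤ v k := fun k => mul_nonneg (by positivity) (le_max_left _ _)
  have hvn : ‖v‖ ^ 2 = V / η ^ 2 := by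
    rw [hv, norm_smul, mul_pow, hV', Real.norm_of_nonneg (by positivity)]; ring
  have key := hP.sum_gap_le hR hη hA κ hz hv0 T
  have hin : n * S * (V / η) ≤
      ∑ t ∈ range T, ∑ j, P.stepSize t * ⟪v, P.gVec ((P.iterates η κ t).1 j)⟫ := by
    have e : n * S * (V / η) = ∑ j, ∑ k, v k * (S * P.g k (P.average η κ T j)) := by
      have h1 : ⟪v, gb⟫ = V / η := by
        rw [hv, real_inner_smul_left, inner_posPartVec_self, hV']; ring
      have h2 : n * ⟪v, gb⟫ = ∑ j, ⟪v, P.gVec (P.average η κ T j)⟫ := by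
        rw [hgb, real_inner_smul_right, inner_sum]; field_simp
      rw [← h1, mul_right_comm, h2, sum_mul]
      refine sum_congr rfl fun j _ => ?_
      rw [PiLp.inner_apply, sum_mul]
      refine sum_congr rfl fun k _ => ?_
      simp only [gVec, RCLike.inner_apply, conj_trivial]; ring
    rw [e, sum_comm (s := range T)]
    refine sum_le_sum fun j _ => ?_
    calc _ ≤ ∑ k, v k * ∑ t ∈ range T, P.stepSize t * P.g k ((P.iterates η κ t).1 j) :=
          sum_le_sum fun k _ =>
            mul_le_mul_of_nonneg_left (hP.gVec_average_le hR η κ hT0 j k) (hv0 k)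
      _ = _ := by
          simp_rw [mul_sum]
          rw [sum_comm]
          refine sum_congr rfl fun t _ => ?_
          rw [PiLp.inner_apply, mul_sum]
          refine sum_congr rfl fun k _ => ?_
          simp only [gVec, RCLike.inner_apply, conj_trivial]; ring
  have hsplit : ∑ t ∈ range T, ∑ j, (2 * P.stepSize t * (P.f j ((P.iterates η κ t).1 j) - P.f j z) +
        2 * P.stepSize t * ⟪v, P.gVec ((P.iterates η κ t).1 j)⟫ +
        P.stepSize t * η * ‖(P.iterates η κ t).2 j‖ ^ 2 - P.stepSize t * η * ‖v‖ ^ 2 -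
        P.stepSize t ^ 2 * (A * (1 + ‖(P.iterates η κ t).2 j‖ ^ 2))) =
      2 * (∑ t ∈ range T, ∑ j, P.stepSize t * ⟪v, P.gVec ((P.iterates η κ t).1 j)⟫) -
      n * S * (η * ‖v‖ ^ 2) -
      ∑ t ∈ range T, ∑ j, (P.stepSize t ^ 2 * (A * (1 + ‖(P.iterates η κ t).2 j‖ ^ 2)) -
        P.stepSize t * η * ‖(P.iterates η κ t).2 j‖ ^ 2 -
        2 * P.stepSize t * (P.f j ((P.iterates η κ t).1 j) - P.f j z)) := by
    have h3 : n * S * (η * ‖v‖ ^ 2) = ∑ t ∈ range T, ∑ _j : Fin n, P.stepSize t * η * ‖v‖ ^ 2 := by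
      simp only [sum_const, card_univ, Fintype.card_fin, nsmul_eq_mul]
      rw [hS, mul_assoc, sum_mul, mul_sum]
      exact sum_congr rfl fun t _ => by ring
    rw [h3]
    simp only [mul_sum, ← sum_sub_distrib]
    exact sum_congr rfl fun t _ => sum_congr rfl fun j _ => by ring
  rw [hsplit] at key
  have h4 : n * S * (η * ‖v‖ ^ 2) = n * S * (V / η) := by rw [hvn]; field_simp
  -- The hypothesis `2 / η ≤ S` lets half of the gain `n S V / η` pay for the initial distance to
  -- `v`.
  have h5 : n * ‖v‖ ^ 2 ≤ n * S * V / (2 * η) := by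
    rw [hvn]
    have : n * (V / η ^ 2) = n * V / (2 * η) * (2 / η) := by field_simp
    rw [this]
    have : n * S * V / (2 * η) = n * V / (2 * η) * S := by ring
    rw [this]
    gcongr
  have h6 : n * S * V / (2 * η) = n * S * (V / η) / 2 := by field_simp
  linarith

end DistProblem

/-! ### Scalar inputs for the sampling error. -/

/-- The right side is the chord of `exp` over `[-b, b]`. Being affine in `x`, it survives
conditional expectation when `b` is predictable and `x` has conditional mean zero. -/
theorem exp_le_cosh_add_mul_sinh_div {x b : ℝ} (h : |x| ≤ b) :
    Real.exp x ≤ Real.cosh b + x * (Real.sinh b / b) := by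
  rcases (abs_nonneg x).trans h |>.eq_or_lt with rfl | hb
  · have : x = 0 := abs_eq_zero.1 (le_antisymm h (abs_nonneg x))
    simp [this]
  · obtain ⟨h1, h2⟩ := abs_le.1 h
    have hc := convexOn_exp.2 (Set.mem_univ b) (Set.mem_univ (-b)) (div_nonneg (a := b + x) (b := 2 * b)
      (by linarith) (by linarith)) (div_nonneg (a := b - x) (b := 2 * b) (by linarith)
      (by linarith)) (by field_simp; ring)
    have e1 : ((b + x) / (2 * b)) • b + ((b - x) / (2 * b)) • (-b) = x := by
      simp only [smul_eq_mul]; field_simp; ring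
    rw [e1] at hc
    refine hc.trans_eq ?_
    rw [Real.cosh_eq, Real.sinh_eq]
    simp only [smul_eq_mul]; field_simp; ring

/-- This is unbiasedness of the sampled sub-gradient. The uniform rule at `v = 0` is immaterial,
since its weight is zero. -/
theorem sampleProb_mul_l1Norm {m : ℕ} {v : EuclideanSpace ℝ (Fin m)} (hv : ∀ k, 0 ≤ v k)
    (k : Fin m) : l1Norm v * sampleProb v k = v k := by
  by_cases h : v = 0
  · simp [h, l1Norm]
  · have h1 : l1Norm v ≠ 0 := by
      intro h0
      rw [l1Norm_eq_sum hv, sum_eq_zero_iff_of_nonneg fun k _ => hv k] at h0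
      exact h (by ext k; simpa using h0 k (mem_univ k))
    rw [sampleProb, if_neg h, mul_div_cancel₀ _ h1]

namespace DistProblem

/-! ### Functionals of finitely many labels -/

/-- A history of length `t` takes finitely many values, so such a factorization settles
measurability and integrability without any bound on `Ψ`. -/
theorem exists_eq_comp_history {n m : ℕ} {Ω : Type*} [Nonempty Ω] (K : ℕ → Ω → Fin n → Fin m)
    {Ψ : (ℕ → Fin n → Fin m) → ℝ} {t : ℕ}
    (hΨ : ∀ κ κ', (∀ s < t, κ s = κ' s) → Ψ κ = Ψ κ') :
    ∃ φ : (Fin t → Fin n → Fin m) → ℝ,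
      (fun ω => Ψ fun s => K s ω) = φ ∘ fun ω (s : Fin t) => K s ω := by
  obtain ⟨ω₀⟩ := ‹Nonempty Ω›
  -- Later labels are irrelevant; an observed value is used as filler, so `Fin m` need not be
  -- assumed non-empty.
  refine ⟨fun h => Ψ fun s => if hs : s < t then h ⟨s, hs⟩ else K 0 ω₀, funext fun ω => ?_⟩
  exact hΨ _ _ fun s hs => by simp [hs]

variable {d n m : ℕ} {P : DistProblem d n m} {η : ℝ} {Ω : Type*} [MeasurableSpace Ω]
  {μ : Measure Ω} [IsProbabilityMeasure μ] {K : ℕ → Ω → Fin n → Fin m}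

theorem IsSampling.integrable (hK : P.IsSampling η μ K) {Ψ : (ℕ → Fin n → Fin m) → ℝ} (t : ℕ)
    (hΨ : ∀ κ κ', (∀ s < t, κ s = κ' s) → Ψ κ = Ψ κ') :
    Integrable (fun ω => Ψ fun s => K s ω) μ := by
  have := μ.nonempty_of_neZero
  obtain ⟨φ, hφ⟩ := exists_eq_comp_history K hΨ
  rw [hφ]
  have hm : Measurable fun ω (s : Fin t) => K s ω := measurable_pi_lambda _ fun s => hK.measurable s
  have := Measure.isProbabilityMeasure_map (μ := μ) hm.aemeasurable
  exact (Integrable.of_finite (f := φ)).comp_measurable hm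

theorem IsSampling.integral_mul_indicator (hK : P.IsSampling η μ K)
    {Ψ : (ℕ → Fin n → Fin m) → ℝ} {t : ℕ}
    (hΨ : ∀ κ κ', (∀ s < t, κ s = κ' s) → Ψ κ = Ψ κ') (i : Fin n) (k : Fin m) :
    ∫ ω, Ψ (fun s => K s ω) * Set.indicator {ω | K t ω i = k} (fun _ => (1 : ℝ)) ω ∂μ =
      ∫ ω, Ψ (fun s => K s ω) * sampleProb ((P.iterates η (fun s => K s ω) t).2 i) k ∂μ := by
  have := μ.nonempty_of_neZero
  obtain ⟨φ, hφ⟩ := exists_eq_comp_history K hΨ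
  have hm : Measurable fun ω (s : Fin t) => K s ω := measurable_pi_lambda _ fun s => hK.measurable s
  have hset : MeasurableSet {ω | K t ω i = k} :=
    (hK.measurable t) (MeasurableSet.of_discrete (s := {a : Fin n → Fin m | a i = k}))
  have hint : Integrable (Set.indicator {ω | K t ω i = k} (fun _ => (1 : ℝ))) μ :=
    (integrable_const 1).indicator hset
  have hF : Integrable (fun ω => Ψ fun s => K s ω) μ := hK.integrable t hΨ
  have hFm : StronglyMeasurable[MeasurableSpace.comap (fun ω (s : Fin t) => K s ω) inferInstance]
      (fun ω => Ψ fun s => K s ω) := by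
    rw [hφ]
    exact ((Measurable.of_discrete (f := φ)).comp (comap_measurable _)).stronglyMeasurable
  have hprod : Integrable ((fun ω => Ψ fun s => K s ω) *
      Set.indicator {ω | K t ω i = k} (fun _ => (1 : ℝ))) μ := by
    have : ((fun ω => Ψ fun s => K s ω) * Set.indicator {ω | K t ω i = k} (fun _ => (1 : ℝ))) =
        Set.indicator {ω | K t ω i = k} (fun ω => Ψ fun s => K s ω) := by
      ext ω; by_cases h : ω ∈ {ω | K t ω i = k} <;> simp [h]
    rw [this]
    exact hF.indicator hset
  have h1 := condExp_mul_of_stronglyMeasurable_left hFm hprod hint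
  calc _ = ∫ ω, (μ[(fun ω => Ψ fun s => K s ω) *
        Set.indicator {ω | K t ω i = k} (fun _ => (1 : ℝ)) |
        MeasurableSpace.comap (fun ω (s : Fin t) => K s ω) inferInstance]) ω ∂μ :=
        (integral_condExp hm.comap_le).symm
    _ = _ := by
        refine integral_congr_ae ?_
        filter_upwards [h1, hK.cond_law t i k] with ω h2 h3
        rw [h2, Pi.mul_apply, h3]

/-! ### Concentration of the sampling error -/

theorem noise_congr (η : ℝ) (z : EuclideanSpace ℝ (Fin d)) {κ κ' : ℕ → Fin n → Fin m} {t : ℕ}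
    (h : ∀ s < t + 1, κ s = κ' s) : P.noise η κ z t = P.noise η κ' z t := by
  rw [noise, noise, iterates_congr η fun s hs => h s (by omega), h t (by omega)]

/-- A bound for the sampling error at step `t` that depends only on the labels drawn before. -/
noncomputable def noiseBound (P : DistProblem d n m) (η : ℝ) (κ : ℕ → Fin n → Fin m) (t : ℕ) : ℝ :=
  P.stepSize t * (4 * P.L * P.R * ∑ j, l1Norm ((P.iterates η κ t).2 j))

theorem noiseBound_congr (η : ℝ) {κ κ' : ℕ → Fin n → Fin m} {t : ℕ}
    (h : ∀ s < t, κ s = κ' s) : P.noiseBound η κ t = P.noiseBound η κ' t := by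
  rw [noiseBound, noiseBound, iterates_congr η h]

theorem Standing.abs_noise_le (hP : P.Standing) (hR : 0 < P.R) (κ : ℕ → Fin n → Fin m)
    {z : EuclideanSpace ℝ (Fin d)} (hz : z ∈ P.ball) (t : ℕ) :
    |P.stepSize t * P.noise η κ z t| ≤ P.noiseBound η κ t := by
  rw [abs_mul, abs_of_pos (stepSize_pos hR t), noiseBound]
  refine mul_le_mul_of_nonneg_left ?_ (stepSize_pos hR t).le
  rw [noise, mul_sum]
  refine (abs_sum_le_sum_abs _ _).trans (sum_le_sum fun j _ => ?_)
  have hx := iterates_fst_mem_ball hR η κ t j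
  have hl := iterates_snd_nonneg (P := P) η κ t j
  generalize (P.iterates η κ t).1 j = x at *
  generalize (P.iterates η κ t).2 j = u at *
  have hL := hP.zero_le_lipschitz
  have hxz : ‖x - z‖ ≤ 2 * P.R :=
    (norm_sub_le _ _).trans (by linarith [mem_ball_iff.1 hx, mem_ball_iff.1 hz])
  have key : ∀ k, |⟪P.dg k x, x - z⟫| ≤ P.L * (2 * P.R) := fun k =>
    (abs_real_inner_le_norm _ _).trans (mul_le_mul (hP.dg_bound k x hx) hxz (norm_nonneg _) hL)
  have h1 : |∑ k, u k * ⟪P.dg k x, x - z⟫| ≤ l1Norm u * (P.L * (2 * P.R)) := by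
    refine (abs_sum_le_sum_abs _ _).trans ?_
    rw [l1Norm, sum_mul]
    refine sum_le_sum fun k _ => ?_
    rw [abs_mul]
    exact mul_le_mul_of_nonneg_left (key k) (abs_nonneg _)
  have h2 : |l1Norm u * ⟪P.dg (κ t j) x, x - z⟫| ≤ l1Norm u * (P.L * (2 * P.R)) := by
    rw [abs_mul, abs_of_nonneg (l1Norm_nonneg u)]
    exact mul_le_mul_of_nonneg_left (key _) (l1Norm_nonneg u)
  exact (abs_sub _ _).trans (by linarith)

/-- The noise is a martingale difference. Each agent's error has conditional mean zero separately,
so no independence between agents is needed. -/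
theorem IsSampling.integral_mul_noise (hK : P.IsSampling η μ K) (z : EuclideanSpace ℝ (Fin d))
    {Ψ : (ℕ → Fin n → Fin m) → ℝ} {t : ℕ}
    (hΨ : ∀ κ κ', (∀ s < t, κ s = κ' s) → Ψ κ = Ψ κ') :
    ∫ ω, Ψ (fun s => K s ω) * P.noise η (fun s => K s ω) z t ∂μ = 0 := by
  set c : Fin n → Fin m → (ℕ → Fin n → Fin m) → ℝ := fun j k κ =>
    ⟪P.dg k ((P.iterates η κ t).1 j), (P.iterates η κ t).1 j - z⟫ with hc
  set u : Fin n → (ℕ → Fin n → Fin m) → EuclideanSpace ℝ (Fin m) := fun j κ =>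
    (P.iterates η κ t).2 j with hu
  set Θ : Fin n → Fin m → (ℕ → Fin n → Fin m) → ℝ := fun j k κ =>
    Ψ κ * c j k κ * l1Norm (u j κ) with hΘ
  have hΘ' : ∀ j k κ κ', (∀ s < t, κ s = κ' s) → Θ j k κ = Θ j k κ' := fun j k κ κ' h => by
    simp only [hΘ, hc, hu]
    rw [hΨ κ κ' h, iterates_congr η h]
  have hind : ∀ j k, Integrable (fun ω => Θ j k (fun s => K s ω) *
      Set.indicator {ω | K t ω j = k} (fun _ => (1 : ℝ)) ω) μ := fun j k => by
    have := hK.integrable (Ψ := fun κ => Θ j k κ * if κ t j = k then 1 else 0) (t + 1)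
      fun κ κ' h => by
        simp only [hΘ' j k κ κ' fun s hs => h s (by omega), h t (by omega)]
    refine this.congr (Eventually.of_forall fun ω => ?_)
    simp [Set.indicator_apply]
  have hprob : ∀ j k, Integrable (fun ω => Θ j k (fun s => K s ω) *
      sampleProb (u j (fun s => K s ω)) k) μ := fun j k =>
    hK.integrable (Ψ := fun κ => Θ j k κ * sampleProb (u j κ) k) t fun κ κ' h => by
      simp only [hΘ' j k κ κ' h, hu, iterates_congr (P := P) η h]
  have hexp : ∀ ω, Ψ (fun s => K s ω) * P.noise η (fun s => K s ω) z t =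
      ∑ j, ∑ k, (Θ j k (fun s => K s ω) * sampleProb (u j (fun s => K s ω)) k -
        Θ j k (fun s => K s ω) * Set.indicator {ω | K t ω j = k} (fun _ => (1 : ℝ)) ω) := by
    intro ω
    rw [noise, mul_sum]
    refine sum_congr rfl fun j _ => ?_
    rw [sum_sub_distrib, mul_sub, mul_sum]
    congr 1
    · refine sum_congr rfl fun k _ => ?_
      rw [← sampleProb_mul_l1Norm (iterates_snd_nonneg η _ t j) k]
      simp only [hΘ, hc, hu]; ring
    · simp only [Set.indicator_apply, Set.mem_ofPred_eq, mul_ite, mul_one, mul_zero]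
      rw [Finset.sum_ite_eq]
      simp only [hΘ, hc, hu, mem_univ, if_true]; ring
  have hd : ∀ j k, Integrable (fun ω => Θ j k (fun s => K s ω) *
      sampleProb (u j (fun s => K s ω)) k - Θ j k (fun s => K s ω) *
        Set.indicator {ω | K t ω j = k} (fun _ => (1 : ℝ)) ω) μ :=
    fun j k => (hprob j k).sub (hind j k)
  simp_rw [hexp]
  rw [integral_finsetSum _ fun j _ => integrable_finsetSum _ fun k _ => hd j k]
  refine sum_eq_zero fun j _ => ?_
  rw [integral_finsetSum _ fun k _ => hd j k]
  refine sum_eq_zero fun k _ => ?_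
  rw [integral_sub (hprob j k) (hind j k), hK.integral_mul_indicator (hΘ' j k), sub_self]

/-- An exponential supermartingale with predictable compensator: the chord bound and `cosh b ≤ exp
(b² / 2)` leave a linear term of mean zero. The bound `b` stays random, so it can be absorbed
pathwise. -/
theorem IsSampling.integral_exp_noise_le (hP : P.Standing) (hR : 0 < P.R)
    (hK : P.IsSampling η μ K) {z : EuclideanSpace ℝ (Fin d)} (hz : z ∈ P.ball) (T : ℕ) :
    ∫ ω, Real.exp (∑ t ∈ range T, (P.stepSize t * P.noise η (fun s => K s ω) z t -
      P.noiseBound η (fun s => K s ω) t ^ 2 / 2)) ∂μ ≤ 1 := by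
  set U : ℕ → (ℕ → Fin n → Fin m) → ℝ := fun T κ =>
    Real.exp (∑ t ∈ range T, (P.stepSize t * P.noise η κ z t - P.noiseBound η κ t ^ 2 / 2)) with hU
  have hUc : ∀ T κ κ', (∀ s < T, κ s = κ' s) → U T κ = U T κ' := fun T κ κ' h => by
    simp only [hU]
    congr 1
    refine sum_congr rfl fun t ht => ?_
    rw [mem_range] at ht
    rw [noise_congr η z fun s hs => h s (by omega), noiseBound_congr η fun s hs => h s (by omega)]
  change ∫ ω, U T (fun s => K s ω) ∂μ ≤ 1
  induction T with
  | zero => simp [hU]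
  | succ T ih =>
    refine le_trans ?_ ih
    set Ψ : (ℕ → Fin n → Fin m) → ℝ := fun κ =>
      U T κ * Real.exp (-(P.noiseBound η κ T ^ 2 / 2)) *
        (Real.sinh (P.noiseBound η κ T) / P.noiseBound η κ T) * P.stepSize T with hΨ
    have hΨc : ∀ κ κ', (∀ s < T, κ s = κ' s) → Ψ κ = Ψ κ' := fun κ κ' h => by
      simp only [hΨ, hUc T κ κ' h, noiseBound_congr (P := P) η h]
    have hi : Integrable (fun ω => Ψ (fun s => K s ω) * P.noise η (fun s => K s ω) z T) μ :=
      hK.integrable (Ψ := fun κ => Ψ κ * P.noise η κ z T) (T + 1) fun κ κ' h => by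
        simp only [hΨc κ κ' fun s hs => h s (by omega), noise_congr (P := P) η z h]
    have hUi := hK.integrable T (hUc T)
    have hpt : ∀ κ, U (T + 1) κ ≤ U T κ + Ψ κ * P.noise η κ z T := fun κ => by
      have h1 := exp_le_cosh_add_mul_sinh_div (hP.abs_noise_le (η := η) hR κ hz T)
      have h2 := Real.cosh_le_exp_half_sq (P.noiseBound η κ T)
      set b := P.noiseBound η κ T
      have h3 : Real.exp (-(b ^ 2 / 2)) * Real.exp (b ^ 2 / 2) = 1 := by
        rw [← Real.exp_add, neg_add_cancel, Real.exp_zero]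
      have h4 : U (T + 1) κ = U T κ * (Real.exp (-(b ^ 2 / 2)) *
          Real.exp (P.stepSize T * P.noise η κ z T)) := by
        simp only [hU]
        rw [sum_range_succ, ← Real.exp_add, ← Real.exp_add]
        congr 1
        ring
      calc U (T + 1) κ ≤ U T κ * (Real.exp (-(b ^ 2 / 2)) * (Real.exp (b ^ 2 / 2) +
            P.stepSize T * P.noise η κ z T * (Real.sinh b / b))) := by
            rw [h4]
            have : 0 ≤ U T κ := (Real.exp_pos _).le
            gcongr
            linarith
        _ = _ := by
            rw [mul_add, h3]
            simp only [hΨ]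
            ring
    calc ∫ ω, U (T + 1) (fun s => K s ω) ∂μ ≤ ∫ ω, (U T (fun s => K s ω) +
          Ψ (fun s => K s ω) * P.noise η (fun s => K s ω) z T) ∂μ :=
          integral_mono (hK.integrable (T + 1) (hUc (T + 1))) (hUi.add hi) fun ω => hpt _
      _ = ∫ ω, U T (fun s => K s ω) ∂μ := by
          rw [integral_add hUi hi, hK.integral_mul_noise z hΨc, add_zero]

/-- Markov's inequality at level `T` for the exponential supermartingale. -/
theorem IsSampling.noise_le_with_high_probability (hP : P.Standing) (hR : 0 < P.R)
    (hK : P.IsSampling η μ K) {z : EuclideanSpace ℝ (Fin d)} (hz : z ∈ P.ball) {T : ℕ}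
    (hT : 0 < T) :
    1 - 1 / (T : ℝ) ≤ μ.real {ω | ∑ t ∈ range T, P.stepSize t * P.noise η (fun s => K s ω) z t ≤
      Real.log T + ∑ t ∈ range T, P.noiseBound η (fun s => K s ω) t ^ 2 / 2} := by
  have hT' : (0 : ℝ) < T := Nat.cast_pos.2 hT
  set F : Ω → ℝ := fun ω => Real.exp (∑ t ∈ range T, (P.stepSize t * P.noise η (fun s => K s ω) z t -
      P.noiseBound η (fun s => K s ω) t ^ 2 / 2)) with hF
  have hFi : Integrable F μ := hK.integrable (Ψ := fun κ => Real.exp (∑ t ∈ range T,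
      (P.stepSize t * P.noise η κ z t - P.noiseBound η κ t ^ 2 / 2))) T fun κ κ' h => by
    congr 1
    refine sum_congr rfl fun t ht => ?_
    rw [mem_range] at ht
    rw [noise_congr η z fun s hs => h s (by omega), noiseBound_congr η fun s hs => h s (by omega)]
  have h1 := (mul_meas_ge_le_integral_of_nonneg
    (Eventually.of_forall fun ω => (Real.exp_pos _).le) hFi (T : ℝ)).trans
      (hK.integral_exp_noise_le hP hR hz T)
  set G := {ω | ∑ t ∈ range T, P.stepSize t * P.noise η (fun s => K s ω) z t ≤
      Real.log T + ∑ t ∈ range T, P.noiseBound η (fun s => K s ω) t ^ 2 / 2} with hG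
  have hcov : (Set.univ : Set Ω) ⊆ G ∪ {ω | (T : ℝ) ≤ F ω} := fun ω _ => by
    by_contra h
    rw [Set.mem_union, not_or] at h
    refine h.2 ?_
    have h3 : Real.log T < ∑ t ∈ range T, (P.stepSize t * P.noise η (fun s => K s ω) z t -
        P.noiseBound η (fun s => K s ω) t ^ 2 / 2) := by
      have := h.1
      rw [hG, Set.mem_ofPred_eq, not_le] at this
      rw [sum_sub_distrib]
      linarith
    exact ((Real.log_lt_iff_lt_exp hT').1 h3).le
  have h4 : (1 : ℝ) ≤ μ.real G + μ.real {ω | (T : ℝ) ≤ F ω} := by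
    have h5 := (measureReal_mono (μ := μ) hcov).trans (measureReal_union_le _ _)
    rwa [probReal_univ] at h5
  have h6 : μ.real {ω | (T : ℝ) ≤ F ω} ≤ 1 / (T : ℝ) := by
    rw [le_div_iff₀ hT']
    linarith
  linarith

end DistProblem

/-! ### Poisson equation for an irreducible doubly stochastic matrix -/

/-- Maximum principle: a maximum spreads to every neighbour, hence along walks. -/
theorem eq_of_harmonic_of_connected {n : ℕ} {G : SimpleGraph (Fin n)} (hG : G.Connected)
    {W : Matrix (Fin n) (Fin n) ℝ} (h0 : ∀ i j, 0 ≤ W i j) (h1 : ∀ i, ∑ j, W i j = 1)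
    (hpos : ∀ i j, G.Adj i j → 0 < W i j) {v : Fin n → ℝ} (hv : ∀ i, v i = ∑ j, W i j * v j)
    (i j : Fin n) : v i = v j := by
  have := hG.nonempty
  obtain ⟨a, -, ha⟩ := exists_max_image univ v univ_nonempty
  have hstep : ∀ i j, G.Adj i j → v i = v a → v j = v a := by
    intro i j hij hi
    have hs : ∑ j, W i j * (v a - v j) = 0 := by
      simp_rw [mul_sub, sum_sub_distrib, ← sum_mul, h1, one_mul, ← hv, hi, sub_self]
    have := (sum_eq_zero_iff_of_nonneg fun j _ =>
      mul_nonneg (h0 i j) (sub_nonneg.2 (ha j (mem_univ j)))).1 hs j (mem_univ j)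
    have := (mul_eq_zero.1 this).resolve_left (hpos i j hij).ne'
    linarith
  have key : ∀ i j, G.Walk i j → v i = v a → v j = v a := by
    intro i j p
    induction p with
    | nil => exact id
    | cons h _ ih => exact fun hi => ih (hstep _ _ h hi)
  have hall : ∀ j, v j = v a := fun j =>
    (hG.preconnected a j).elim fun p => key a j p rfl
  rw [hall i, hall j]

/-- Adding the averaging matrix to `1 - Wᵀ` removes its kernel, the constants. Invertibility uses
irreducibility only, so periodic `W` are allowed. -/
theorem exists_poisson_solution {n : ℕ} {E : Type*} [AddCommGroup E] [Module ℝ E]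
    {G : SimpleGraph (Fin n)} (hG : G.Connected) {W : Matrix (Fin n) (Fin n) ℝ}
    (hW : W ∈ doublyStochastic ℝ (Fin n)) (hpos : ∀ i j, G.Adj i j → 0 < W i j) (l : Fin n → E) :
    ∃ h : Fin n → E, ∀ i, l i - (1 / (n : ℝ)) • ∑ j, l j = h i - ∑ j, W j i • h j := by
  obtain ⟨h0, h1, h2⟩ := mem_doublyStochastic_iff_sum.1 hW
  have hn : (n : ℝ) ≠ 0 := by
    obtain ⟨i⟩ := hG.nonempty
    exact Nat.cast_ne_zero.2 i.pos.ne'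
  set M : Matrix (Fin n) (Fin n) ℝ :=
    1 - W.transpose + (1 / (n : ℝ)) • Matrix.of fun _ _ => 1 with hM
  have hMv : ∀ (v : Fin n → ℝ) i,
      M.mulVec v i = v i - ∑ j, W j i * v j + (1 / (n : ℝ)) * ∑ j, v j := fun v i => by
    simp [hM, Matrix.mulVec, dotProduct, add_mul, sub_mul, sum_add_distrib, sum_sub_distrib,
      mul_sum, Matrix.one_apply]
  have hinj : Function.Injective M.mulVec := by
    refine (injective_iff_map_eq_zero M.mulVecLin).2 fun v hv => ?_
    have hv' : ∀ i, v i - ∑ j, W j i * v j + (1 / (n : ℝ)) * ∑ j, v j = 0 := fun i => by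
      rw [← hMv]
      exact congrFun hv i
    have hsum : ∑ j, v j = 0 := by
      have h3 : ∑ i, (v i - ∑ j, W j i * v j + (1 / (n : ℝ)) * ∑ j, v j) = 0 :=
        sum_eq_zero fun i _ => hv' i
      rw [sum_add_distrib, sum_sub_distrib, sum_comm] at h3
      simp_rw [← sum_mul, h1, one_mul] at h3
      simpa [hn] using h3
    have hharm : ∀ i, v i = ∑ j, W.transpose i j * v j := fun i => by
      have := hv' i
      rw [hsum, mul_zero, add_zero] at this
      simpa [Matrix.transpose_apply] using sub_eq_zero.1 this
    have hc := eq_of_harmonic_of_connected hG (W := W.transpose) (fun i j => h0 j i) h2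
      (fun i j hij => hpos j i hij.symm) hharm
    funext i
    have : ∑ j, v j = n * v i := by
      rw [sum_congr rfl fun j _ => hc j i]
      simp
    simpa [hn, hsum] using this
  have hunit : IsUnit M := Matrix.mulVec_injective_iff_isUnit.1 hinj
  have hMinv : M * M⁻¹ = 1 := Matrix.mul_nonsing_inv M ((Matrix.isUnit_iff_isUnit_det M).1 hunit)
  set h : Fin n → E := fun i => ∑ k, M⁻¹ i k • l k with hh
  have hsol : ∀ i, h i - ∑ j, W j i • h j + (1 / (n : ℝ)) • ∑ j, h j = l i := by
    intro i
    have e : h i - ∑ j, W j i • h j + (1 / (n : ℝ)) • ∑ j, h j = ∑ j, M i j • h j := by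
      simp only [hM, Matrix.add_apply, Matrix.sub_apply, Matrix.transpose_apply, Matrix.smul_apply,
        Matrix.of_apply, smul_eq_mul, mul_one, add_smul, sub_smul, sum_add_distrib,
        sum_sub_distrib, smul_sum]
      simp [Matrix.one_apply]
    rw [e]
    simp_rw [hh, smul_sum, smul_smul]
    rw [sum_comm]
    refine (sum_congr rfl fun k _ => by
      rw [← sum_smul, ← Matrix.mul_apply, hMinv]).trans ?_
    simp [Matrix.one_apply]
  -- Summing the equations cancels `h - Wᵀ h`, which identifies the mean of `h` with that of `l`.
  have hs : ∑ j, h j = ∑ j, l j := by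
    rw [← sum_congr rfl fun i _ => hsol i, sum_add_distrib, sum_sub_distrib,
      sum_comm (f := fun i j => W j i • h j)]
    simp_rw [← sum_smul, h1, one_smul, sub_self, zero_add]
    rw [sum_const, card_univ, Fintype.card_fin, ← Nat.cast_smul_eq_nsmul ℝ, smul_eq_mul,
      mul_one_div_cancel hn, one_smul]
  exact ⟨h, fun i => by rw [← hsol i, ← hs]; abel⟩

theorem sum_mul_sub_succ_le {a c : ℕ → ℝ} {B : ℝ} (ha : Antitone a) (ha0 : ∀ t, 0 ≤ a t)
    (hc : ∀ t, |c t| ≤ B) (T : ℕ) : ∑ t ∈ range T, a t * (c t - c (t + 1)) ≤ 2 * B * a 0 := by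
  -- Summation by parts, with the boundary term kept on the left to make the induction close.
  have key : ∑ t ∈ range T, a t * (c t - c (t + 1)) + a T * c T ≤ B * (2 * a 0 - a T) := by
    induction T with
    | zero =>
      have := mul_le_mul_of_nonneg_left (abs_le.1 (hc 0)).2 (ha0 0)
      simp
      linarith
    | succ T ih =>
      rw [sum_range_succ]
      have := mul_le_mul_of_nonneg_left (abs_le.1 (hc (T + 1))).1 (sub_nonneg.2 (ha T.le_succ))
      linarith
  have := mul_le_mul_of_nonneg_left (abs_le.1 (hc T)).1 (ha0 T)
  linarith

namespace DistProblem

variable {d n m : ℕ} {P : DistProblem d n m}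

/-! ### Interior optima -/

/-- Strict feasibility keeps a short segment from `z` towards `y` feasible, so by convexity local
optimality becomes global on the ball. -/
theorem Standing.le_on_ball_of_isOptimal (hP : P.Standing) {z : EuclideanSpace ℝ (Fin d)}
    (hz : P.IsOptimal z) (hzg : ∀ k, P.g k z < 0) {y : EuclideanSpace ℝ (Fin d)}
    (hy : y ∈ P.ball) : ∑ i, P.f i z ≤ ∑ i, P.f i y := by
  have hzb := hP.feasible_subset hz.1
  have hn : (0 : ℝ) < n := Nat.cast_pos.2 hP.card_pos
  obtain ⟨ε, hε⟩ : ∃ ε : ℝ, 0 < ε ∧ ε < 1 ∧ ∀ k, (1 - ε) * P.g k z + ε * P.g k y ≤ 0 := by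
    have h1 : ∀ᶠ ε : ℝ in nhdsWithin 0 (Set.Ioi 0),
        ∀ k, (1 - ε) * P.g k z + ε * P.g k y ≤ 0 := by
      refine eventually_all.2 fun k => ?_
      have hcont : ContinuousAt (fun ε : ℝ => (1 - ε) * P.g k z + ε * P.g k y) 0 := by fun_prop
      have : ∀ᶠ ε : ℝ in nhds 0, (1 - ε) * P.g k z + ε * P.g k y < 0 :=
        hcont.eventually_lt_const (by simpa using hzg k)
      exact (this.filter_mono nhdsWithin_le_nhds).mono fun _ h => h.le
    have h2 : ∀ᶠ ε : ℝ in nhdsWithin 0 (Set.Ioi 0), ε < 1 :=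
      (eventually_lt_nhds one_pos).filter_mono nhdsWithin_le_nhds
    exact ((eventually_mem_nhdsWithin.and (h2.and h1)).exists)
  obtain ⟨hε0, hε1, hεg⟩ := hε
  have hfeas : (1 - ε) • z + ε • y ∈ P.feasible := fun k =>
    ((hP.g_convex k).2 hzb hy (by linarith) hε0.le (by ring)).trans (hεg k)
  have h3 : ∑ i, P.f i z ≤ ∑ i, P.f i ((1 - ε) • z + ε • y) :=
    le_of_mul_le_mul_left (hz.2 _ hfeas) (by positivity)
  have h4 : ∑ i, P.f i ((1 - ε) • z + ε • y) ≤ (1 - ε) * ∑ i, P.f i z + ε * ∑ i, P.f i y := by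
    rw [mul_sum, mul_sum, ← sum_add_distrib]
    exact sum_le_sum fun i _ => (hP.f_convex i).2 hzb hy (by linarith) hε0.le (by ring)
  nlinarith

/-- The `l i` form a sub-gradient at `0` of the optimal value as a function of the disagreement `u i
= x i - w`. -/
theorem Standing.exists_functionals (hP : P.Standing) {z : EuclideanSpace ℝ (Fin d)}
    (hz : z ∈ P.ball) (hmin : ∀ y ∈ P.ball, ∑ i, P.f i z ≤ ∑ i, P.f i y) :
    ∃ l : Fin n → EuclideanSpace ℝ (Fin d) →L[ℝ] ℝ,
      ∀ x : Fin n → EuclideanSpace ℝ (Fin d), (∀ i, x i ∈ P.ball) → ∀ w ∈ P.ball,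
        ∑ i, P.f i z + ∑ i, l i (x i - w) ≤ ∑ i, P.f i (x i) := by
  have hL := hP.zero_le_lipschitz
  -- Strict epigraph of the value function with the constraint `x i - w = u i` replaced by an
  -- `L`-Lipschitz penalty. The penalty makes the set open and the function finite everywhere; it is
  -- exact at `u = 0` because `f` is `L`-Lipschitz on the ball.
  set S : Set ((Fin n → EuclideanSpace ℝ (Fin d)) × ℝ) :=
    {p | ∃ x : Fin n → EuclideanSpace ℝ (Fin d), (∀ i, x i ∈ P.ball) ∧ ∃ w ∈ P.ball,
      ∑ i, P.f i (x i) + P.L * ∑ i, ‖x i - w - p.1 i‖ < p.2} with hS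
  have hopen : IsOpen S := by
    refine isOpen_iff_mem_nhds.2 fun p ⟨x, hx, w, hw, h⟩ => ?_
    have : ∀ᶠ q : (Fin n → EuclideanSpace ℝ (Fin d)) × ℝ in nhds p,
        ∑ i, P.f i (x i) + P.L * ∑ i, ‖x i - w - q.1 i‖ < q.2 :=
      (isOpen_lt (by fun_prop) (by fun_prop)).mem_nhds h
    filter_upwards [this] with q hq using ⟨x, hx, w, hw, hq⟩
  have hconv : Convex ℝ S := by
    rintro p ⟨x, hx, w, hw, h⟩ q ⟨x', hx', w', hw', h'⟩ a b ha hb hab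
    refine ⟨fun i => a • x i + b • x' i, fun i => convex_ball (hx i) (hx' i) ha hb hab,
      a • w + b • w', convex_ball hw hw' ha hb hab, ?_⟩
    have h1 : ∑ i, P.f i (a • x i + b • x' i) ≤
        a * ∑ i, P.f i (x i) + b * ∑ i, P.f i (x' i) := by
      rw [mul_sum, mul_sum, ← sum_add_distrib]
      exact sum_le_sum fun i _ => (hP.f_convex i).2 (hx i) (hx' i) ha hb hab
    have h2 : ∑ i, ‖a • x i + b • x' i - (a • w + b • w') - (a • p + b • q).1 i‖ ≤
        a * ∑ i, ‖x i - w - p.1 i‖ + b * ∑ i, ‖x' i - w' - q.1 i‖ := by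
      rw [mul_sum, mul_sum, ← sum_add_distrib]
      refine sum_le_sum fun i _ => ?_
      have e : a • x i + b • x' i - (a • w + b • w') - (a • p + b • q).1 i =
          a • (x i - w - p.1 i) + b • (x' i - w' - q.1 i) := by
        simp only [Prod.fst_add, Prod.smul_fst, Pi.add_apply, Pi.smul_apply]
        module
      rw [e]
      refine (norm_add_le _ _).trans_eq ?_
      rw [norm_smul, norm_smul, Real.norm_of_nonneg ha, Real.norm_of_nonneg hb]
    have h3 := mul_le_mul_of_nonneg_left h2 hL
    have h4 : a * (∑ i, P.f i (x i) + P.L * ∑ i, ‖x i - w - p.1 i‖) +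
        b * (∑ i, P.f i (x' i) + P.L * ∑ i, ‖x' i - w' - q.1 i‖) < a * p.2 + b * q.2 := by
      rcases ha.eq_or_lt with rfl | ha'
      · have : b = 1 := by linarith
        subst this
        linarith
      · exact add_lt_add_of_lt_of_le (mul_lt_mul_of_pos_left h ha')
          (mul_le_mul_of_nonneg_left h'.le hb)
    calc _ ≤ _ := add_le_add h1 h3
      _ < a * p.2 + b * q.2 := by linarith
      _ = (a • p + b • q).2 := rfl
  have hnot : ((0, ∑ i, P.f i z) : (Fin n → EuclideanSpace ℝ (Fin d)) × ℝ) ∉ S := by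
    rintro ⟨x, hx, w, hw, h⟩
    have h1 : ∑ i, P.f i w - ∑ i, P.f i (x i) ≤ P.L * ∑ i, ‖x i - w‖ := by
      rw [← sum_sub_distrib, mul_sum]
      exact sum_le_sum fun i _ => by
        rw [norm_sub_rev]
        exact hP.f_sub_le i hw (hx i)
    simp only [Pi.zero_apply, sub_zero] at h
    linarith [hmin w hw]
  obtain ⟨φ, hφ⟩ := geometric_hahn_banach_open_point hconv hopen hnot
  set c := φ (0, 1) with hc
  have hsplit : ∀ u r, φ (u, r) = φ (u, 0) + r * c := fun u r => by
    have : ((u, r) : (Fin n → EuclideanSpace ℝ (Fin d)) × ℝ) = (u, 0) + r • (0, 1) := by simp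
    rw [this, map_add, map_smul, smul_eq_mul]
  have h0 : φ ((0 : Fin n → EuclideanSpace ℝ (Fin d)), (0 : ℝ)) = 0 := map_zero φ
  -- The separating hyperplane is not vertical, since a point directly above the base point lies in
  -- `S`.
  have hc0 : c < 0 := by
    have h1 := hφ (0, ∑ i, P.f i z + 1) ⟨fun _ => z, fun _ => hz, z, hz, by simp⟩
    rw [hsplit, hsplit 0 (∑ i, P.f i z)] at h1
    linarith
  refine ⟨fun i => (-c)⁻¹ • (φ.comp (ContinuousLinearMap.inl ℝ _ ℝ)).comp
    (ContinuousLinearMap.single ℝ (fun _ => EuclideanSpace ℝ (Fin d)) i), fun x hx w hw => ?_⟩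
  have hsum : ∑ i, ((-c)⁻¹ • (φ.comp (ContinuousLinearMap.inl ℝ _ ℝ)).comp
      (ContinuousLinearMap.single ℝ (fun _ => EuclideanSpace ℝ (Fin d)) i)) (x i - w) =
      (-c)⁻¹ * φ (fun i => x i - w, 0) := by
    have e : (fun i => x i - w) = ∑ i, Pi.single i (x i - w) :=
      (univ_sum_single fun i => x i - w).symm
    have : φ (fun i => x i - w, 0) = (φ.comp (ContinuousLinearMap.inl ℝ _ ℝ)) fun i => x i - w := rfl
    rw [this, e, map_sum, mul_sum]
    rfl
  rw [hsum]
  have hle : φ (fun i => x i - w, 0) + (∑ i, P.f i (x i)) * c ≤ (∑ i, P.f i z) * c := by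
    refine le_of_forall_pos_le_add fun ε hε => ?_
    have h1 := hφ (fun i => x i - w, ∑ i, P.f i (x i) + ε / (-c)) ⟨x, hx, w, hw, by
      simp only [sub_self, norm_zero, sum_const_zero, mul_zero, add_zero]
      linarith [div_pos hε (neg_pos.2 hc0)]⟩
    rw [hsplit, hsplit 0, h0] at h1
    have h2 : ε / (-c) * c = -ε := by rw [div_neg, neg_mul, div_mul_cancel₀ _ hc0.ne]
    linarith
  have h5 : (-c)⁻¹ * φ (fun i => x i - w, 0) ≤ ∑ i, P.f i (x i) - ∑ i, P.f i z := by
    rw [inv_mul_le_iff₀ (neg_pos.2 hc0)]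
    linarith
  linarith

theorem Standing.norm_fst_succ_sub_le (hP : P.Standing) (hR : 0 < P.R) (η : ℝ)
    (κ : ℕ → Fin n → Fin m) (t : ℕ) (i : Fin n) :
    ‖(P.iterates η κ (t + 1)).1 i - ∑ j, P.W i j • (P.iterates η κ t).1 j‖ ≤
      P.stepSize t * ∑ j, P.W i j * (P.L * (1 + l1Norm ((P.iterates η κ t).2 j))) := by
  obtain ⟨h0, h1, -⟩ := mem_doublyStochastic_iff_sum.1 hP.doublyStoch
  have hmem : ∑ j, P.W i j • (P.iterates η κ t).1 j ∈ P.ball :=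
    convex_ball.sum_mem (fun j _ => h0 i j) (h1 i) fun j _ => iterates_fst_mem_ball hR η κ t j
  rw [iterates_fst_succ]
  refine (norm_projBall_sub_le hR _ (mem_ball_iff.1 hmem)).trans ?_
  rw [← sum_sub_distrib]
  simp_rw [← smul_sub, sub_sub_cancel_left]
  refine (norm_sum_smul_le _ (h0 i) _).trans ?_
  rw [mul_sum]
  refine sum_le_sum fun j _ => ?_
  rw [norm_neg, norm_smul, Real.norm_of_nonneg (stepSize_pos hR t).le, mul_left_comm]
  have ha := (stepSize_pos hR t).le
  have := h0 i j
  gcongr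
  exact hP.norm_gradX_le j (iterates_fst_mem_ball hR η κ t j) _ _

/-- The objective gap cannot be very negative on average, although the agents may never agree: the
functionals of disagreement become increments of `∑ h i (x i)` plus errors of order `α`, and
summation by parts bounds the increments. -/
theorem Standing.exists_sum_f_sub_ge (hP : P.Standing) (hR : 0 < P.R)
    {z : EuclideanSpace ℝ (Fin d)} (hz : z ∈ P.ball)
    (hmin : ∀ y ∈ P.ball, ∑ i, P.f i z ≤ ∑ i, P.f i y) :
    ∃ C B : ℝ, 0 ≤ C ∧ 0 ≤ B ∧ ∀ (η : ℝ) (κ : ℕ → Fin n → Fin m) (T : ℕ),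
      -(∑ t ∈ range T, ∑ j, 2 * P.stepSize t * (P.f j ((P.iterates η κ t).1 j) - P.f j z)) ≤
        C + ∑ t ∈ range T, ∑ j, P.stepSize t ^ 2 * (B * (1 + ‖(P.iterates η κ t).2 j‖ ^ 2)) := by
  obtain ⟨l, hl⟩ := hP.exists_functionals hz hmin
  obtain ⟨h, hh⟩ := exists_poisson_solution hP.connected hP.doublyStoch hP.weight_pos l
  obtain ⟨h0, h1, h2⟩ := mem_doublyStochastic_iff_sum.1 hP.doublyStoch
  have hn : (0 : ℝ) < n := Nat.cast_pos.2 hP.card_pos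
  have hL := hP.zero_le_lipschitz
  set H := ∑ i, ‖h i‖ with hH
  have hHi : ∀ i, ‖h i‖ ≤ H := fun i =>
    single_le_sum (f := fun i => ‖h i‖) (fun _ _ => norm_nonneg _) (mem_univ i)
  have hH0 : 0 ≤ H := sum_nonneg fun _ _ => norm_nonneg _
  have ha0 := stepSize_pos hR 0
  refine ⟨4 * (H * P.R) * P.stepSize 0, 2 * (H * (P.L * (2 + m))), by positivity, by positivity,
    fun η κ T => ?_⟩
  set x := fun t => (P.iterates η κ t).1 with hx
  set c : ℕ → ℝ := fun t => -∑ i, h i (x t i) with hc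
  have hxb : ∀ t i, x t i ∈ P.ball := fun t i => iterates_fst_mem_ball hR η κ t i
  have hcb : ∀ t, |c t| ≤ H * P.R := fun t => by
    rw [hc, abs_neg, hH, sum_mul]
    refine (abs_sum_le_sum_abs _ _).trans (sum_le_sum fun i _ => ?_)
    exact (h i).le_opNorm_of_le (mem_ball_iff.1 (hxb t i))
  have hlin : ∀ t, ∑ i, h i (x t i - ∑ j, P.W i j • x t j) ≤
      ∑ j, (P.f j (x t j) - P.f j z) := fun t => by
    -- Taking `w` to be the mean produces exactly the centred functionals of the Poisson equation.
    have hmean : ∑ j, (1 / (n : ℝ)) • x t j ∈ P.ball :=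
      convex_ball.sum_mem (fun j _ => by positivity) (by simp [hn.ne']) fun j _ => hxb t j
    have h3 := hl (x t) (hxb t) _ hmean
    have e1 : ∑ i, l i (x t i - ∑ j, (1 / (n : ℝ)) • x t j) =
        ∑ i, (l i - (1 / (n : ℝ)) • ∑ j, l j) (x t i) := by
      simp only [map_sub, map_sum, map_smul, sub_apply,
        smul_apply, _root_.sum_apply, sum_sub_distrib, smul_sum]
      rw [sum_comm (f := fun i j => (1 / (n : ℝ)) • l i (x t j))]
    have e2 : ∑ i, (h i - ∑ j, P.W j i • h j) (x t i) =
        ∑ i, h i (x t i - ∑ j, P.W i j • x t j) := by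
      simp only [map_sub, map_sum, map_smul, sub_apply,
        smul_apply, _root_.sum_apply, sum_sub_distrib]
      rw [sum_comm (f := fun i j => P.W j i • h j (x t i))]
    have e3 : ∑ i, (l i - (1 / (n : ℝ)) • ∑ j, l j) (x t i) =
        ∑ i, (h i - ∑ j, P.W j i • h j) (x t i) := sum_congr rfl fun i _ => by rw [hh i]
    rw [e1, e3, e2] at h3
    rw [sum_sub_distrib]
    linarith
  have hstep : ∀ t, -(P.stepSize t * ∑ j, (P.f j (x t j) - P.f j z)) ≤
      P.stepSize t * (c t - c (t + 1)) +
        ∑ j, P.stepSize t ^ 2 * (H * (P.L * (2 + m)) * (1 + ‖(P.iterates η κ t).2 j‖ ^ 2)) := by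
    intro t
    have ha := (stepSize_pos hR t).le
    have h4 : -∑ i, h i (x (t + 1) i - ∑ j, P.W i j • x t j) ≤
        ∑ j, P.stepSize t * (H * (P.L * (2 + m)) * (1 + ‖(P.iterates η κ t).2 j‖ ^ 2)) := by
      calc -∑ i, h i (x (t + 1) i - ∑ j, P.W i j • x t j)
          ≤ ∑ i, H * (P.stepSize t *
            ∑ j, P.W i j * (P.L * (1 + l1Norm ((P.iterates η κ t).2 j)))) := by
            rw [← sum_neg_distrib]
            refine sum_le_sum fun i _ => (neg_le_abs _).trans ?_
            refine ((h i).le_opNorm _).trans ?_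
            exact mul_le_mul (hHi i) (hP.norm_fst_succ_sub_le hR η κ t i) (norm_nonneg _) hH0
        _ = ∑ j, H * (P.stepSize t * (P.L * (1 + l1Norm ((P.iterates η κ t).2 j)))) := by
            simp_rw [mul_sum]
            rw [sum_comm]
            refine sum_congr rfl fun j _ => ?_
            rw [← mul_sum, ← mul_sum, ← sum_mul, h2, one_mul]
        _ ≤ _ := by
            refine sum_le_sum fun j _ => ?_
            have h5 : 1 + l1Norm ((P.iterates η κ t).2 j) ≤
                (2 + m) * (1 + ‖(P.iterates η κ t).2 j‖ ^ 2) := by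
              nlinarith [sq_l1Norm_le ((P.iterates η κ t).2 j),
                sq_nonneg (l1Norm ((P.iterates η κ t).2 j) - 1),
                sq_nonneg ‖(P.iterates η κ t).2 j‖, l1Norm_nonneg ((P.iterates η κ t).2 j),
                (Nat.cast_nonneg m : (0 : ℝ) ≤ m)]
            calc _ ≤ H * (P.stepSize t * (P.L * ((2 + m) * (1 + ‖(P.iterates η κ t).2 j‖ ^ 2)))) := by
                  gcongr
              _ = _ := by ring
    have h6 : ∑ i, h i (x t i - ∑ j, P.W i j • x t j) = -(c t - c (t + 1)) +
        ∑ i, h i (x (t + 1) i - ∑ j, P.W i j • x t j) := by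
      simp only [hc, map_sub, sum_sub_distrib]
      ring
    have h7 := mul_le_mul_of_nonneg_left (hlin t) ha
    have h8 := mul_le_mul_of_nonneg_left h4 ha
    rw [h6] at h7
    have h9 : P.stepSize t *
        ∑ j, P.stepSize t * (H * (P.L * (2 + m)) * (1 + ‖(P.iterates η κ t).2 j‖ ^ 2)) =
        ∑ j, P.stepSize t ^ 2 * (H * (P.L * (2 + m)) * (1 + ‖(P.iterates η κ t).2 j‖ ^ 2)) := by
      rw [mul_sum]
      exact sum_congr rfl fun j _ => by ring
    linarith
  have habel := sum_mul_sub_succ_le (stepSize_antitone hR) (fun t => (stepSize_pos hR t).le) hcb T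
  calc -(∑ t ∈ range T, ∑ j, 2 * P.stepSize t * (P.f j (x t j) - P.f j z))
      = 2 * ∑ t ∈ range T, -(P.stepSize t * ∑ j, (P.f j (x t j) - P.f j z)) := by
        rw [sum_neg_distrib, mul_neg, mul_sum]
        simp_rw [mul_sum, mul_assoc]
    _ ≤ 2 * ∑ t ∈ range T, (P.stepSize t * (c t - c (t + 1)) +
        ∑ j, P.stepSize t ^ 2 * (H * (P.L * (2 + m)) * (1 + ‖(P.iterates η κ t).2 j‖ ^ 2))) := by
        gcongr with t
        exact hstep t
    _ = 2 * ∑ t ∈ range T, P.stepSize t * (c t - c (t + 1)) + ∑ t ∈ range T, ∑ j,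
        P.stepSize t ^ 2 * (2 * (H * (P.L * (2 + m))) * (1 + ‖(P.iterates η κ t).2 j‖ ^ 2)) := by
        rw [sum_add_distrib, mul_add]
        congr 1
        simp_rw [mul_sum]
        exact sum_congr rfl fun t _ => sum_congr rfl fun j _ => by ring
    _ ≤ _ := by linarith

end DistProblem

namespace DistProblem

variable {d n m : ℕ} {P : DistProblem d n m}

/-! ### Step sizes -/

theorem tendsto_stepSize : Tendsto P.stepSize atTop (nhds 0) := by
  refine Tendsto.div_atTop tendsto_const_nhds ?_
  exact Real.tendsto_sqrt_atTop.comp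
    (tendsto_atTop_add_const_right _ _ tendsto_natCast_atTop_atTop)

theorem sum_sq_stepSize_le (T : ℕ) :
    ∑ t ∈ range T, P.stepSize t ^ 2 ≤ P.R ^ 2 * (1 + Real.log T) := by
  have h : ∑ t ∈ range T, P.stepSize t ^ 2 = P.R ^ 2 * (harmonic T : ℚ) := by
    simp_rw [sq_stepSize, harmonic, div_eq_mul_inv, ← mul_sum]
    push_cast
    rfl
  rw [h]
  exact mul_le_mul_of_nonneg_left (harmonic_le_one_add_log T) (sq_nonneg _)

theorem le_sum_stepSize (hR : 0 < P.R) (T : ℕ) :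
    P.R * √(T : ℝ) ≤ ∑ t ∈ range T, P.stepSize t := by
  rcases Nat.eq_zero_or_pos T with rfl | hT
  · simp
  have hT' : (0 : ℝ) < T := Nat.cast_pos.2 hT
  have h : ∑ _t ∈ range T, P.R / √(T : ℝ) ≤ ∑ t ∈ range T, P.stepSize t := by
    refine sum_le_sum fun t ht => ?_
    have : (t : ℝ) + 1 ≤ T := by exact_mod_cast mem_range.1 ht
    unfold stepSize
    gcongr
  refine le_trans (le_of_eq ?_) h
  rw [sum_const, card_range, nsmul_eq_mul]
  have hs := Real.sq_sqrt hT'.le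
  field_simp
  linarith

/-- Only finitely many terms are non-zero, as `α A < η` eventually. -/
theorem exists_sum_max_stepSize_le {A η : ℝ} (hη : 0 < η) (hR : 0 < P.R) :
    ∃ C : ℝ, ∀ T : ℕ, ∑ t ∈ range T, max 0 (P.stepSize t ^ 2 * A - P.stepSize t * η) ≤ C := by
  have h0 : ∀ᶠ t in atTop, P.stepSize t * A < η :=
    (by simpa using (tendsto_stepSize (P := P)).mul_const A :
      Tendsto (fun t => P.stepSize t * A) atTop (nhds 0)).eventually_lt_const hη
  obtain ⟨t₀, ht₀⟩ := eventually_atTop.1 h0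
  refine ⟨∑ t ∈ range t₀, max 0 (P.stepSize t ^ 2 * A - P.stepSize t * η), fun T => ?_⟩
  refine (sum_le_sum_of_subset_of_nonneg (range_subset_range.2 (le_max_left T t₀))
    fun _ _ _ => le_max_left _ _).trans (le_of_eq (sum_subset
      (range_subset_range.2 (le_max_right T t₀)) fun t _ ht => ?_).symm)
  rw [mem_range, not_lt] at ht
  refine max_eq_left ?_
  nlinarith [ht₀ t ht, stepSize_pos hR t]

/-! ### High probability bound -/

theorem noiseBound_sq_le (η : ℝ) (κ : ℕ → Fin n → Fin m) (t : ℕ) :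
    P.noiseBound η κ t ^ 2 ≤ ∑ j, P.stepSize t ^ 2 *
      ((4 * P.L * P.R) ^ 2 * (n * m) * (1 + ‖(P.iterates η κ t).2 j‖ ^ 2)) := by
  have h1 := sq_sum_le_card_mul_sum_sq (s := univ) (f := fun j => l1Norm ((P.iterates η κ t).2 j))
  rw [card_univ, Fintype.card_fin] at h1
  have h2 : ∑ j, l1Norm ((P.iterates η κ t).2 j) ^ 2 ≤
      ∑ j, m * (1 + ‖(P.iterates η κ t).2 j‖ ^ 2) := sum_le_sum fun j _ =>
    (sq_l1Norm_le _).trans (mul_le_mul_of_nonneg_left (by linarith) (Nat.cast_nonneg m))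
  have h3 := h1.trans (mul_le_mul_of_nonneg_left h2 (Nat.cast_nonneg n))
  calc _ = P.stepSize t ^ 2 * (4 * P.L * P.R) ^ 2 *
        (∑ j, l1Norm ((P.iterates η κ t).2 j)) ^ 2 := by rw [noiseBound]; ring
    _ ≤ P.stepSize t ^ 2 * (4 * P.L * P.R) ^ 2 *
        (n * ∑ j, m * (1 + ‖(P.iterates η κ t).2 j‖ ^ 2)) := by gcongr
    _ = _ := by
      simp_rw [mul_sum]
      exact sum_congr rfl fun j _ => by ring

/-- Common core of both parts; `e` is the allowed linear loss in the objective, zero for an interior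
optimum. It matters that `D` is independent of `η`, while `C'` need not be. -/
theorem Standing.exists_high_probability_bound.{u} (hP : P.Standing) (hR : 0 < P.R)
    {z : EuclideanSpace ℝ (Fin d)} (hz : z ∈ P.feasible) {C₀ B e : ℝ} (hB : 0 ≤ B)
    (hf : ∀ (η : ℝ) (κ : ℕ → Fin n → Fin m) (T : ℕ),
      -(∑ t ∈ range T, ∑ j, 2 * P.stepSize t * (P.f j ((P.iterates η κ t).1 j) - P.f j z)) ≤
        C₀ + e * ∑ t ∈ range T, P.stepSize t +
        ∑ t ∈ range T, ∑ j, P.stepSize t ^ 2 * (B * (1 + ‖(P.iterates η κ t).2 j‖ ^ 2))) :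
    ∃ D : ℝ, 0 ≤ D ∧ ∀ η : ℝ, 0 < η → (∀ t : ℕ, η * P.stepSize t ≤ 1 / 2) → ∃ C' : ℝ,
      ∀ᶠ T : ℕ in atTop, ∀ (Ω : Type u) [MeasurableSpace Ω] (μ : Measure Ω)
        [IsProbabilityMeasure μ] (K : ℕ → Ω → Fin n → Fin m), P.IsSampling η μ K →
          1 - 1 / (T : ℝ) ≤ μ.real {ω | n * (∑ t ∈ range T, P.stepSize t) *
            P.violation η (fun s => K s ω) T / (2 * η) ≤
              D * Real.log T + C' + e * ∑ t ∈ range T, P.stepSize t} := by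
  obtain ⟨A, hA0, hA⟩ := hP.exists_sq_grad_le hR
  obtain ⟨Γ, hΓ0, hΓ⟩ := hP.exists_norm_gVec_le
  have hL := hP.zero_le_lipschitz
  set N := (4 * P.L * P.R) ^ 2 * (n * m) with hN
  have hN0 : 0 ≤ N := by positivity
  -- Gradients, objective gap and noise compensator all have the form `α² (1 + ‖λ‖²)` and are
  -- absorbed together.
  set A' := A + B + N with hA'
  have hA'0 : 0 ≤ A' := by positivity
  refine ⟨2 + n * A' * P.R ^ 2, by positivity, fun η hη hα => ?_⟩
  obtain ⟨C₁, hC₁⟩ := exists_sum_max_stepSize_le (P := P) (A := A') hη hR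
  refine ⟨n * P.R ^ 2 + C₀ + n * A' * P.R ^ 2 + n * ((Γ / η) ^ 2 * C₁), ?_⟩
  have hS : ∀ᶠ T : ℕ in atTop, 2 / η ≤ ∑ t ∈ range T, P.stepSize t := by
    have : Tendsto (fun T : ℕ => P.R * √(T : ℝ)) atTop atTop :=
      (Real.tendsto_sqrt_atTop.comp tendsto_natCast_atTop_atTop).const_mul_atTop hR
    filter_upwards [this.eventually_ge_atTop (2 / η)] with T hT using hT.trans (le_sum_stepSize hR T)
  filter_upwards [hS, eventually_gt_atTop 0] with T hT hT0 Ω _ μ _ K hK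
  refine (hK.noise_le_with_high_probability hP hR (hP.feasible_subset hz) hT0).trans
    (measureReal_mono fun ω hω => ?_)
  rw [Set.mem_ofPred_eq] at hω ⊢
  generalize (fun s => K s ω) = κ at hω ⊢
  have h1 := hP.violation_le hR hη (hA η hη hα) κ hz hT
  have h2 := hf η κ T
  have h3 : 2 * ∑ t ∈ range T, P.noiseBound η κ t ^ 2 / 2 ≤ ∑ t ∈ range T, ∑ j,
      P.stepSize t ^ 2 * (N * (1 + ‖(P.iterates η κ t).2 j‖ ^ 2)) := by
    rw [mul_sum]
    refine sum_le_sum fun t _ => ?_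
    rw [mul_div_cancel₀ _ two_ne_zero]
    exact noiseBound_sq_le η κ t
  have h4 : ∑ t ∈ range T, ∑ j, (P.stepSize t ^ 2 * (A' * (1 + ‖(P.iterates η κ t).2 j‖ ^ 2)) -
      P.stepSize t * η * ‖(P.iterates η κ t).2 j‖ ^ 2) ≤
      n * A' * (P.R ^ 2 * (1 + Real.log T)) + n * ((Γ / η) ^ 2 * C₁) := by
    calc _ ≤ ∑ t ∈ range T, ∑ _j : Fin n, (P.stepSize t ^ 2 * A' +
          max 0 (P.stepSize t ^ 2 * A' - P.stepSize t * η) * (Γ / η) ^ 2) := by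
          refine sum_le_sum fun t _ => sum_le_sum fun j _ => ?_
          have h5 := pow_le_pow_left₀ (norm_nonneg _)
            (hP.norm_iterates_snd_le hR hΓ0 hΓ hη hα κ t j) 2
          have h6 := mul_le_mul (le_max_right 0 (P.stepSize t ^ 2 * A' - P.stepSize t * η)) h5
            (sq_nonneg _) (le_max_left _ _)
          linarith
      _ = n * A' * ∑ t ∈ range T, P.stepSize t ^ 2 + n * ((Γ / η) ^ 2 *
          ∑ t ∈ range T, max 0 (P.stepSize t ^ 2 * A' - P.stepSize t * η)) := by
          simp only [sum_const, card_univ, Fintype.card_fin, nsmul_eq_mul]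
          simp_rw [mul_sum, ← sum_add_distrib]
          exact sum_congr rfl fun t _ => by ring
      _ ≤ _ := by
          have := hC₁ T
          have := sum_sq_stepSize_le (P := P) T
          gcongr
  have h7 : ∑ t ∈ range T, ∑ j, (P.stepSize t ^ 2 * (A' * (1 + ‖(P.iterates η κ t).2 j‖ ^ 2)) -
      P.stepSize t * η * ‖(P.iterates η κ t).2 j‖ ^ 2) =
      ∑ t ∈ range T, ∑ j, (P.stepSize t ^ 2 * (A * (1 + ‖(P.iterates η κ t).2 j‖ ^ 2)) -
        P.stepSize t * η * ‖(P.iterates η κ t).2 j‖ ^ 2 -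
        2 * P.stepSize t * (P.f j ((P.iterates η κ t).1 j) - P.f j z)) +
      ∑ t ∈ range T, ∑ j, 2 * P.stepSize t * (P.f j ((P.iterates η κ t).1 j) - P.f j z) +
      ∑ t ∈ range T, ∑ j, P.stepSize t ^ 2 * (B * (1 + ‖(P.iterates η κ t).2 j‖ ^ 2)) +
      ∑ t ∈ range T, ∑ j, P.stepSize t ^ 2 * (N * (1 + ‖(P.iterates η κ t).2 j‖ ^ 2)) := by
    simp only [← sum_add_distrib]
    exact sum_congr rfl fun t _ => sum_congr rfl fun j _ => by ring
  linarith

/-! ### Zero radius and the two final bounds. -/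

theorem Standing.violation_eq_zero (hP : P.Standing) (hR : P.R = 0) (η : ℝ)
    (κ : ℕ → Fin n → Fin m) (T : ℕ) : P.violation η κ T = 0 := by
  have h0 : (0 : EuclideanSpace ℝ (Fin d)) ∈ P.feasible := by
    obtain ⟨x, hx⟩ := hP.feasible_nonempty
    have : ‖x‖ ≤ 0 := hR ▸ mem_ball_iff.1 (hP.feasible_subset hx)
    rwa [norm_le_zero_iff.1 this] at hx
  -- All step sizes vanish, and the weighted average is zero.
  have hav : ∀ i, P.average η κ T i = 0 := fun i => by simp [average, stepSize, hR]
  have : posPartVec ((1 / (n : ℝ)) • ∑ i, P.gVec (P.average η κ T i)) = 0 := by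
    ext k
    refine max_eq_left ?_
    simp only [hav, sum_const, card_univ, Fintype.card_fin, PiLp.smul_apply, smul_eq_mul,
      nsmul_eq_mul]
    exact mul_nonpos_of_nonneg_of_nonpos (by positivity)
      (mul_nonpos_of_nonneg_of_nonpos (Nat.cast_nonneg n) (h0 k))
  rw [violation, this, norm_zero, sq, zero_mul]

theorem tendsto_log_div_sqrt :
    Tendsto (fun T : ℕ => Real.log T / √(T : ℝ)) atTop (nhds 0) := by
  have h := (isLittleO_log_rpow_atTop (r := 1 / 2) (by norm_num)).tendsto_div_nhds_zero
  simp_rw [← Real.sqrt_eq_rpow] at h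
  exact h.comp tendsto_natCast_atTop_atTop

theorem Standing.exists_violation_le.{u} (hP : P.Standing) (hR : 0 < P.R) :
    ∃ C : ℝ, ∀ η : ℝ, 0 < η → (∀ t : ℕ, η * P.stepSize t ≤ 1 / 2) →
      ∀ᶠ T : ℕ in atTop, ∀ (Ω : Type u) [MeasurableSpace Ω] (μ : Measure Ω)
        [IsProbabilityMeasure μ] (K : ℕ → Ω → Fin n → Fin m), P.IsSampling η μ K →
          1 - 1 / (T : ℝ) ≤ μ.real {ω | P.violation η (fun s => K s ω) T ≤ C * η} := by
  obtain ⟨z, hz⟩ := hP.feasible_nonempty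
  have hn : (0 : ℝ) < n := Nat.cast_pos.2 hP.card_pos
  set e := 2 * (n * (P.L * (2 * P.R))) with he
  obtain ⟨D, hD, h⟩ := hP.exists_high_probability_bound hR hz (C₀ := 0) (B := 0) (e := e) le_rfl
    fun η κ T => by
      simp only [zero_mul, mul_zero, sum_const_zero, zero_add, add_zero]
      rw [← sum_neg_distrib, mul_sum]
      refine sum_le_sum fun t _ => ?_
      have h1 : ∀ j, P.f j z - P.f j ((P.iterates η κ t).1 j) ≤ P.L * (2 * P.R) := fun j => by
        have hx := iterates_fst_mem_ball hR η κ t j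
        have hzb := hP.feasible_subset hz
        refine (hP.f_sub_le j hzb hx).trans
          (mul_le_mul_of_nonneg_left ((norm_sub_le _ _).trans ?_) hP.zero_le_lipschitz)
        linarith [mem_ball_iff.1 hx, mem_ball_iff.1 hzb]
      have ha := stepSize_pos hR t
      calc _ = ∑ j, 2 * P.stepSize t * (P.f j z - P.f j ((P.iterates η κ t).1 j)) := by
            rw [← sum_neg_distrib]
            exact sum_congr rfl fun j _ => by ring
        _ ≤ ∑ _j : Fin n, 2 * P.stepSize t * (P.L * (2 * P.R)) :=
            sum_le_sum fun j _ => mul_le_mul_of_nonneg_left (h1 j) (by positivity)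
        _ = e * P.stepSize t := by
            simp only [sum_const, card_univ, Fintype.card_fin, nsmul_eq_mul, he]
            ring
  -- For large `T`, `D log T + C' ≤ S`, so the whole right side is at most `(1 + e) S`.
  refine ⟨2 * (1 + e) / n, fun η hη hα => ?_⟩
  obtain ⟨C', hC'⟩ := h η hη hα
  have hlim : Tendsto (fun T : ℕ => D * (Real.log T / √(T : ℝ)) + C' / √(T : ℝ)) atTop
      (nhds 0) := by
    have h2 : Tendsto (fun T : ℕ => C' / √(T : ℝ)) atTop (nhds 0) :=
      tendsto_const_nhds.div_atTop (Real.tendsto_sqrt_atTop.comp tendsto_natCast_atTop_atTop)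
    simpa using (tendsto_log_div_sqrt.const_mul D).add h2
  filter_upwards [hC', hlim.eventually_lt_const hR, eventually_gt_atTop 0]
    with T hT hT1 hT0 Ω _ μ _ K hK
  refine (hT Ω μ K hK).trans (measureReal_mono fun ω hω => ?_)
  rw [Set.mem_ofPred_eq] at hω ⊢
  have hs : 0 < √(T : ℝ) := Real.sqrt_pos.2 (Nat.cast_pos.2 hT0)
  have hS := le_sum_stepSize hR T
  set S := ∑ t ∈ range T, P.stepSize t
  have hS0 : 0 < S := (mul_pos hR hs).trans_le hS
  have h3 : D * Real.log T + C' ≤ S := by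
    have := mul_le_mul_of_nonneg_right hT1.le hs.le
    rw [add_mul, mul_assoc, div_mul_cancel₀ _ hs.ne', div_mul_cancel₀ _ hs.ne'] at this
    linarith
  rw [div_le_iff₀ (by positivity)] at hω
  have h4 : n * S * P.violation η (fun s => K s ω) T ≤ n * S * (2 * (1 + e) / n * η) := by
    refine hω.trans ?_
    have : n * S * (2 * (1 + e) / n * η) = (S + e * S) * (2 * η) := by field_simp
    rw [this]
    gcongr
  exact le_of_mul_le_mul_left h4 (by positivity)

theorem Standing.exists_violation_le_of_isOptimal.{u} (hP : P.Standing) (hR : 0 < P.R)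
    {z : EuclideanSpace ℝ (Fin d)} (hz : P.IsOptimal z) (hzg : ∀ k, P.g k z < 0) :
    ∃ C : ℝ, ∀ η : ℝ, 0 < η → (∀ t : ℕ, η * P.stepSize t ≤ 1 / 2) →
      ∀ᶠ T : ℕ in atTop, ∀ (Ω : Type u) [MeasurableSpace Ω] (μ : Measure Ω)
        [IsProbabilityMeasure μ] (K : ℕ → Ω → Fin n → Fin m), P.IsSampling η μ K →
          1 - 1 / (T : ℝ) ≤ μ.real {ω | P.violation η (fun s => K s ω) T ≤
            C * (η * Real.log T / √(T : ℝ))} := by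
  have hn : (0 : ℝ) < n := Nat.cast_pos.2 hP.card_pos
  obtain ⟨C₀, B, -, hB, hf⟩ := hP.exists_sum_f_sub_ge hR (hP.feasible_subset hz.1)
    fun y hy => hP.le_on_ball_of_isOptimal hz hzg hy
  obtain ⟨D, hD, h⟩ := hP.exists_high_probability_bound hR hz.1 (C₀ := C₀) (e := 0) hB
    fun η κ T => by simpa using hf η κ T
  -- The extra `1` absorbs `C' ≤ log T`; the factor `R` comes from `S ≥ R √T`.
  refine ⟨2 * (D + 1) / (n * P.R), fun η hη hα => ?_⟩
  obtain ⟨C', hC'⟩ := h η hη hα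
  have hlog : ∀ᶠ T : ℕ in atTop, max C' 0 ≤ Real.log T :=
    (Real.tendsto_log_atTop.comp tendsto_natCast_atTop_atTop).eventually_ge_atTop _
  filter_upwards [hC', hlog, eventually_gt_atTop 0] with T hT hT1 hT0 Ω _ μ _ K hK
  refine (hT Ω μ K hK).trans (measureReal_mono fun ω hω => ?_)
  rw [Set.mem_ofPred_eq] at hω ⊢
  obtain ⟨hC, hl0⟩ := max_le_iff.1 hT1
  have hs : 0 < √(T : ℝ) := Real.sqrt_pos.2 (Nat.cast_pos.2 hT0)
  have hS := le_sum_stepSize hR T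
  set S := ∑ t ∈ range T, P.stepSize t
  have hS0 : 0 < S := (mul_pos hR hs).trans_le hS
  rw [div_le_iff₀ (by positivity), zero_mul, add_zero] at hω
  have h4 : n * S * P.violation η (fun s => K s ω) T ≤
      n * S * (2 * (D + 1) / (n * P.R) * (η * Real.log T / √(T : ℝ))) := by
    refine hω.trans ?_
    have : n * S * (2 * (D + 1) / (n * P.R) * (η * Real.log T / √(T : ℝ))) =
        ((D + 1) * Real.log T) * (2 * η) * (S / (P.R * √(T : ℝ))) := by field_simp
    rw [this]
    have h5 : 1 ≤ S / (P.R * √(T : ℝ)) := (one_le_div (by positivity)).2 hS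
    calc _ ≤ ((D + 1) * Real.log T) * (2 * η) := by gcongr; linarith
      _ ≤ _ := le_mul_of_one_le_right (by positivity) h5
  exact le_of_mul_le_mul_left h4 (by positivity)

theorem Standing.one_sub_le_measureReal_violation (hP : P.Standing) (hR : P.R = 0) (η : ℝ) {c : ℝ}
    (hc : 0 ≤ c) (T : ℕ) {Ω : Type*} [MeasurableSpace Ω] (μ : Measure Ω) [IsProbabilityMeasure μ]
    (K : ℕ → Ω → Fin n → Fin m) :
    1 - 1 / (T : ℝ) ≤ μ.real {ω | P.violation η (fun s => K s ω) T ≤ c} := by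
  have : {ω | P.violation η (fun s => K s ω) T ≤ c} = Set.univ :=
    Set.eq_univ_of_forall fun ω => by
      rw [Set.mem_ofPred_eq, hP.violation_eq_zero hR]
      exact hc
  rw [this, probReal_univ]
  linarith [(by positivity : (0 : ℝ) ≤ 1 / (T : ℝ))]

end DistProblem

theorem theorem4 {d n m : ℕ} (P : DistProblem d n m) (hP : P.Standing) :
    (∃ C : ℝ, ∀ η : ℝ, 0 < η → (∀ t : ℕ, η * P.stepSize t ≤ 1 / 2) →
      ∀ᶠ T : ℕ in atTop, ∀ (Ω : Type*) [MeasurableSpace Ω] (μ : Measure Ω) [IsProbabilityMeasure μ]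
        (K : ℕ → Ω → Fin n → Fin m), P.IsSampling η μ K →
          1 - 1 / (T : ℝ) ≤ μ.real {ω | P.violation η (fun s => K s ω) T ≤ C * η}) ∧
    ((∃ x, P.IsOptimal x ∧ ∀ k, P.g k x < 0) →
      ∃ C : ℝ, ∀ η : ℝ, 0 < η → (∀ t : ℕ, η * P.stepSize t ≤ 1 / 2) →
        ∀ᶠ T : ℕ in atTop, ∀ (Ω : Type*) [MeasurableSpace Ω] (μ : Measure Ω)
          [IsProbabilityMeasure μ] (K : ℕ → Ω → Fin n → Fin m), P.IsSampling η μ K →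
            1 - 1 / (T : ℝ) ≤ μ.real {ω | P.violation η (fun s => K s ω) T
              ≤ C * (η * Real.log T / √(T : ℝ))}) := by
  rcases hP.zero_le_radius.eq_or_lt with hR | hR
  · exact ⟨⟨0, fun η _ _ => Eventually.of_forall fun T Ω _ μ _ K _ =>
        hP.one_sub_le_measureReal_violation hR.symm η (by simp) T μ K⟩,
      fun _ => ⟨0, fun η _ _ => Eventually.of_forall fun T Ω _ μ _ K _ =>
        hP.one_sub_le_measureReal_violation hR.symm η (by simp) T μ K⟩⟩
  · exact ⟨hP.exists_violation_le hR, fun ⟨_, hz, hzg⟩ =>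
      hP.exists_violation_le_of_isOptimal hR hz hzg⟩
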